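/- Let $\pi:S^7\subset\mathbb{C}^4\to\mathbb{C}P^3$ be the Hopf fibration, $g_\circ$ the Fubini–Study metric (making $\pi$ a Riemannian submersion) and $J_\circ$ the standard complex structure. Identify $\mathbb{C}^4=\mathbb{H}^2$ by $(z_0,z_1,z_2,z_3)\mapsto(z_0+z_1j,\,z_2+z_3j)$, let $\mathcal D_1^2$ be the image under $d\pi$ of $\operatorname{span}\{jp,kp\}$, $p\in S^7$, and let $P$ be $-1$ on $\mathcal D_1^2$ and $+1$ on its $g_\circ$-orthogonal complement. The nearly Kähler structure of $\mathbb{C}P^3$ is $J=PJ_\circ$, $g(X,Y)=\tfrac32 g_\circ(X,Y)+\tfrac12 g_\circ(X,PY)$; put $G(X,Y)=(\nabla_XJ)Y$ with $\nabla$ the Levi-Civita connection of $g$. Let $M$ be a totally real surface of nearly Kähler $\mathbb{C}P^3$, i.e. a smooth 2-manifold with a smooth immersion into $\mathbb{C}P^3$ such that $g(X,JY)=0$ for all $X,Y$ tangent to $M$. Then there is an open dense subset $W$ of $M$ such that each point of $W$ has an open neighbourhood $N\subset W$ with smooth tangent fields $U,V$ on $N$ for which $$U,\;V,\;JU,\;JV,\;G(U,V),\;JG(U,V)$$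 is a $g$-orthonormal frame of $T\mathbb{C}P^3$ along $N$, $g_\circ(U,V)=0$, and $$J_\circ U=b_1V+b_2JU+b_4G(U,V)+b_5JG(U,V),\qquad J_\circ V=-b_1U+c_3JV+c_4G(U,V)+c_5JG(U,V)$$ with $b_1\ge 0$ and with coefficients of one of the following three types on all of $N$. * Type 0: there are smooth functions $\lambda,\alpha,\theta$ on $N$ with $\alpha\in\,]-\frac\pi2,\frac\pi2[$ and $(\lambda^2,\alpha)\neq(1,0)$ at every point, such that $$b_1=\tfrac{\lambda}{1+\lambda^2}(1-\sin\alpha),\quad b_2=\tfrac{\lambda^2+\sin\alpha}{1+\lambda^2},\quad b_4=\tfrac{\cos\alpha\sin\theta}{\sqrt{1+\lambda^2}},\quad b_5=\tfrac{\cos\alpha\cos\theta}{\sqrt{1+\lambda^2}},$$ $$c_3=\tfrac{1+\lambda^2\sin\alpha}{1+\lambda^2},\quad c_4=\tfrac{\lambda\cos\alpha\cos\theta}{\sqrt{1+\lambda^2}},\quad c_5=-\tfrac{\lambda\cos\alpha\sin\theta}{\sqrt{1+\lambda^2}}.$$ * Type 1: $b_1=b_2=c_3=\frac12$, $b_4=-c_5=\frac1{\sqrt2}$,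 $b_5=c_4=0$. * Type 2: there is a smooth function $\alpha$ on $N$ such that $b_1=\cos\alpha$, $b_2=\sin\alpha$, $c_3=-\sin\alpha$, $b_4=b_5=c_4=c_5=0$. Moreover, the three types do not overlap: at no point of $M$ are there two $g$-orthonormal tangent frames, equal or not, in which $J_\circ$ takes (at that point) the form of two different types. -/

import Mathlib

open scoped Manifold ContDiff LinearAlgebra.Projectivization Topology InnerProductSpace

/-- `ℂ⁴` with its Hermitian inner product; it is identified with `ℍ²` by
`(v₀, v₁, v₂, v₃) ↦ (v₀ + v₁ j, v₂ + v₃ j)`, scalars acting on the left. -/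
abbrev C4 : Type := EuclideanSpace ℂ (Fin 4)
/-- `ℂ³`, the model space of `ℂP³`. -/
abbrev C3 : Type := EuclideanSpace ℂ (Fin 3)
/-- Complex projective 3-space. -/
abbrev CP3 : Type := ℙ ℂ C4

namespace CP3

noncomputable section

/-! ### `ℂP³` as a smooth manifold -/

/-- The quotient topology. -/
instance instTopologicalSpace : TopologicalSpace CP3 :=
  inferInstanceAs (TopologicalSpace (Quotient (projectivizationSetoid ℂ C4)))

/-- `z ↦ (1, z)`. -/
def affineEmb (z : C3) : C4 := !₂[1, z 0, z 1, z 2]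

theorem affineEmb_ne_zero (z : C3) : affineEmb z ≠ 0 := fun h => by
  have := congrArg (fun v : C4 => v 0) h
  simp [affineEmb] at this

/-- The projection `ℂ⁴ ∖ 0 → ℂP³`, `v ↦ [v]`; on the unit sphere `S⁷` it is the Hopf fibration.
The value at `0` is irrelevant. -/
def hopf (v : C4) : CP3 :=
  if h : v ≠ 0 then Projectivization.mk ℂ v h
  else Projectivization.mk ℂ (affineEmb 0) (affineEmb_ne_zero 0)

theorem hopf_of_ne {v : C4} (h : v ≠ 0) : hopf v = Projectivization.mk ℂ v h := dif_pos h

theorem hopf_rep (x : CP3) : hopf x.rep = x := by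
  rw [hopf_of_ne x.rep_nonzero, Projectivization.mk_rep]

theorem hopf_smul {v : C4} {c : ℂ} (hv : v ≠ 0) (hc : c ≠ 0) : hopf (c • v) = hopf v := by
  rw [hopf_of_ne hv, hopf_of_ne (smul_ne_zero hc hv), Projectivization.mk_eq_mk_iff']
  exact ⟨c, rfl⟩

theorem exists_rep_hopf {v : C4} (hv : v ≠ 0) : ∃ c : ℂ, c ≠ 0 ∧ (hopf v).rep = c • v := by
  rw [hopf_of_ne hv]
  obtain ⟨a, ha⟩ := Projectivization.exists_smul_eq_mk_rep ℂ v hv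
  exact ⟨a, a.ne_zero, ha.symm⟩

theorem isQuotientMap_hopf :
    Topology.IsQuotientMap (fun v : {v : C4 // v ≠ 0} => hopf v) := by
  have : (fun v : {v : C4 // v ≠ 0} => hopf v) =
      (Quotient.mk (projectivizationSetoid ℂ C4)) := by
    funext v
    exact hopf_of_ne v.2
  rw [this]
  exact isQuotientMap_quotient_mk'

theorem continuousOn_hopf : ContinuousOn hopf {v | v ≠ 0} := by
  rw [continuousOn_iff_continuous_domRestrict]
  exact isQuotientMap_hopf.continuous

/-- `v ↦ (v₁/v₀, v₂/v₀, v₃/v₀)`. -/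
def ratio (v : C4) : C3 := !₂[v 1 / v 0, v 2 / v 0, v 3 / v 0]

theorem ratio_smul {c : ℂ} (hc : c ≠ 0) (v : C4) : ratio (c • v) = ratio v := by
  simp [ratio, mul_div_mul_left _ _ hc]

theorem ratio_affineEmb (z : C3) : ratio (affineEmb z) = z := by
  ext i; fin_cases i <;> simp [ratio, affineEmb]

theorem smul_affineEmb_ratio {v : C4} (hv : v 0 ≠ 0) : v 0 • affineEmb (ratio v) = v := by
  ext i; fin_cases i <;> simp [ratio, affineEmb, mul_div_cancel₀ _ hv]

theorem contDiffOn_ratio : ContDiffOn ℂ ω ratio {v | v 0 ≠ 0} := by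
  rw [contDiffOn_euclidean]
  have h : ∀ i : Fin 4, ContDiffOn ℂ ω (fun v : C4 => v i) {v | v 0 ≠ 0} := fun i =>
    (contDiff_euclidean.1 contDiff_id i).contDiffOn
  intro i
  fin_cases i
  · exact (h 1).div (h 0) fun _ hv => hv
  · exact (h 2).div (h 0) fun _ hv => hv
  · exact (h 3).div (h 0) fun _ hv => hv

theorem contDiff_affineEmb : ContDiff ℂ ω affineEmb := by
  rw [contDiff_euclidean]
  have h : ∀ i : Fin 3, ContDiff ℂ ω (fun v : C3 => v i) := fun i =>
    contDiff_euclidean.1 contDiff_id i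
  intro i
  fin_cases i
  · exact contDiff_const
  · exact h 0
  · exact h 1
  · exact h 2

/-- The affine chart of `ℂP³` attached to a linear change of coordinates `A` of `ℂ⁴`; its inverse
is `z ↦ [A (1, z)]`. -/
def affineChart (A : C4 ≃L[ℂ] C4) : OpenPartialHomeomorph CP3 C3 where
  toFun x := ratio (A.symm x.rep)
  invFun z := hopf (A (affineEmb z))
  source := {x | (A.symm x.rep) 0 ≠ 0}
  target := Set.univ
  map_source' _ _ := Set.mem_univ _
  map_target' z _ := by
    obtain ⟨c, hc, h⟩ := exists_rep_hopf (v := A (affineEmb z)) (by simpa using affineEmb_ne_zero z)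
    have h0 : affineEmb z 0 = 1 := rfl
    change (A.symm (hopf (A (affineEmb z))).rep) 0 ≠ 0
    rw [h, map_smul, A.symm_apply_apply, PiLp.smul_apply, h0]
    simpa using hc
  left_inv' x hx := by
    have hx' : (A.symm x.rep) 0 ≠ 0 := hx
    rw [← hopf_smul (by simpa using affineEmb_ne_zero _) hx', ← map_smul,
      smul_affineEmb_ratio hx', A.apply_symm_apply, hopf_rep]
  right_inv' z _ := by
    obtain ⟨c, hc, h⟩ := exists_rep_hopf (v := A (affineEmb z)) (by simpa using affineEmb_ne_zero z)
    rw [h, map_smul, ratio_smul hc, A.symm_apply_apply, ratio_affineEmb]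
  continuousOn_toFun := by
    have hs : IsOpen {x : CP3 | (A.symm x.rep) 0 ≠ 0} := by
      rw [← isQuotientMap_hopf.isOpen_preimage]
      have : (fun v : {v : C4 // v ≠ 0} => hopf v) ⁻¹' {x : CP3 | (A.symm x.rep) 0 ≠ 0} =
          {v | (A.symm v.1) 0 ≠ 0} := by
        ext v
        obtain ⟨c, hc, h⟩ := exists_rep_hopf v.2
        simp [h, hc]
      rw [this]
      exact isOpen_ne_fun (by fun_prop) continuous_const
    rw [isQuotientMap_hopf.continuousOn_isOpen_iff hs]
    have h1 : ∀ v : {v : C4 // v ≠ 0},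
        ratio (A.symm (hopf v).rep) = ratio (A.symm v.1) := fun v => by
      obtain ⟨c, hc, h⟩ := exists_rep_hopf v.2
      rw [h, map_smul, ratio_smul hc]
    have h2 : ((fun x : CP3 => ratio (A.symm x.rep)) ∘ fun v : {v : C4 // v ≠ 0} => hopf v) =
        fun v => ratio (A.symm v.1) := funext h1
    rw [h2]
    refine contDiffOn_ratio.continuousOn.comp (by fun_prop) fun v hv => ?_
    obtain ⟨c, hc, h⟩ := exists_rep_hopf v.2
    simpa [h, hc] using hv
  continuousOn_invFun := by
    refine continuousOn_hopf.comp
      (A.continuous.comp contDiff_affineEmb.continuous).continuousOn fun z _ => ?_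
    simpa using affineEmb_ne_zero z
  open_source := by
    rw [← isQuotientMap_hopf.isOpen_preimage]
    have : (fun v : {v : C4 // v ≠ 0} => hopf v) ⁻¹' {x : CP3 | (A.symm x.rep) 0 ≠ 0} =
        {v | (A.symm v.1) 0 ≠ 0} := by
      ext v
      obtain ⟨c, hc, h⟩ := exists_rep_hopf v.2
      simp [h, hc]
    rw [this]
    exact isOpen_ne_fun (by fun_prop) continuous_const
  open_target := isOpen_univ

/-- Left multiplication by the quaternion `j` on `ℍ² = ℂ⁴`. -/
def quatJ (v : C4) : C4 := !₂[-star (v 1), star (v 0), -star (v 3), star (v 2)]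

/-- Every point of `ℂP³` is `[A e₀]` for some `A ∈ Sp(2)`, that is, some unitary `A` which commutes
with `j`. -/
theorem exists_frame (x : CP3) : ∃ A : C4 ≃ₗᵢ[ℂ] C4,
    (∀ v, A (quatJ v) = quatJ (A v)) ∧ hopf (A (affineEmb 0)) = x := by
  obtain ⟨p, hp, hpx⟩ : ∃ p : C4, ‖p‖ = 1 ∧ hopf p = x := by
    have h0 : ‖x.rep‖ ≠ 0 := norm_ne_zero_iff.2 x.rep_nonzero
    refine ⟨((‖x.rep‖⁻¹ : ℝ) : ℂ) • x.rep, by simp [norm_smul, h0], ?_⟩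
    rw [hopf_smul x.rep_nonzero (by exact_mod_cast inv_ne_zero h0), hopf_rep]
  obtain ⟨q, hq, hpq, hjq⟩ : ∃ q : C4, ‖q‖ = 1 ∧ ⟪p, q⟫_ℂ = 0 ∧ ⟪quatJ p, q⟫_ℂ = 0 := by
    set S : Submodule ℂ C4 := Submodule.span ℂ (({p, quatJ p} : Finset C4) : Set C4)
    have h1 : Module.finrank ℂ S ≤ 2 := (finrank_span_finset_le_card _).trans Finset.card_le_two
    have h2 := S.finrank_add_finrank_orthogonal
    have h3 : Module.finrank ℂ C4 = 4 := by simp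
    have h4 : Sᗮ ≠ ⊥ := fun h => by
      rw [h, finrank_bot] at h2
      omega
    obtain ⟨w, hw, hw0⟩ := Submodule.exists_mem_ne_zero_of_ne_bot h4
    have hn : ‖w‖ ≠ 0 := norm_ne_zero_iff.2 hw0
    have hS : ∀ u ∈ S, ⟪u, w⟫_ℂ = 0 := (Submodule.mem_orthogonal S w).1 hw
    refine ⟨((‖w‖⁻¹ : ℝ) : ℂ) • w, by simp [norm_smul, hn], ?_, ?_⟩
    · rw [inner_smul_right, hS p (Submodule.subset_span (by simp)), mul_zero]
    · rw [inner_smul_right, hS (quatJ p) (Submodule.subset_span (by simp)), mul_zero]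
  have hj : ∀ a b : C4, ⟪quatJ a, quatJ b⟫_ℂ = ⟪b, a⟫_ℂ := fun a b => by
    simp [quatJ, PiLp.inner_apply, Fin.sum_univ_four]; ring
  have haj : ∀ a : C4, ⟪a, quatJ a⟫_ℂ = 0 := fun a => by
    simp [quatJ, PiLp.inner_apply, Fin.sum_univ_four]; ring
  have hja : ∀ a b : C4, ⟪a, quatJ b⟫_ℂ = -⟪b, quatJ a⟫_ℂ := fun a b => by
    simp [quatJ, PiLp.inner_apply, Fin.sum_univ_four]; ring
  have hqp : ⟪q, p⟫_ℂ = 0 := by rw [← inner_conj_symm, hpq, map_zero]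
  have hqjp : ⟪q, quatJ p⟫_ℂ = 0 := by rw [← inner_conj_symm, hjq, map_zero]
  have hpjq : ⟪p, quatJ q⟫_ℂ = 0 := by rw [hja, hqjp, neg_zero]
  have hflip : ∀ a b : C4, ⟪a, b⟫_ℂ = 0 → ⟪b, a⟫_ℂ = 0 := fun a b h => by
    rw [← inner_conj_symm, h, map_zero]
  have hpp : ⟪p, p⟫_ℂ = 1 := inner_self_eq_one_of_norm_eq_one hp
  have hqq : ⟪q, q⟫_ℂ = 1 := inner_self_eq_one_of_norm_eq_one hq
  have hon : Orthonormal ℂ ![p, quatJ p, q, quatJ q] := by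
    rw [orthonormal_iff_ite]
    intro i k
    fin_cases i <;> fin_cases k <;>
      simp [-inner_self_eq_norm_sq_to_K, hpp, hqq, hj, haj, hpq, hqp, hjq, hqjp, hpjq,
        hflip _ _ (haj _), hflip _ _ hpjq]
  have hcard : Fintype.card (Fin 4) = Module.finrank ℂ C4 := by simp
  let b : OrthonormalBasis (Fin 4) ℂ C4 :=
    (basisOfOrthonormalOfCardEqFinrank hon hcard).toOrthonormalBasis (by simpa using hon)
  have hb : ∀ i, b i = ![p, quatJ p, q, quatJ q] i := fun i => by simp [b]
  have hA : ∀ v : C4, b.repr.symm v =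
      v 0 • p + v 1 • quatJ p + v 2 • q + v 3 • quatJ q := fun v => by
    rw [← b.sum_repr (b.repr.symm v)]
    simp [Fin.sum_univ_four, hb]
  refine ⟨b.repr.symm, fun v => ?_, ?_⟩
  · rw [hA, hA]
    ext i; fin_cases i <;> simp [quatJ] <;> ring
  · rw [hA]; simpa [affineEmb] using hpx

/-- A choice, for every point `x`, of an element of `Sp(2)` that moves `[e₀]` to `x`. -/
def frame (x : CP3) : C4 ≃ₗᵢ[ℂ] C4 := (exists_frame x).choose

theorem hopf_frame (x : CP3) : hopf (frame x (affineEmb 0)) = x := (exists_frame x).choose_spec.2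

/-- The atlas consists of all affine charts. The preferred chart at `x` is centred at `x`. -/
instance instChartedSpace : ChartedSpace C3 CP3 where
  atlas := Set.range affineChart
  chartAt x := affineChart (frame x).toContinuousLinearEquiv
  mem_chart_source x := by
    have := (affineChart (frame x).toContinuousLinearEquiv).map_target (x := 0) (Set.mem_univ _)
    rwa [show (affineChart (frame x).toContinuousLinearEquiv).symm 0 = x from hopf_frame x] at this
  chart_mem_atlas x := Set.mem_range_self _

instance instIsManifold : IsManifold 𝓘(ℝ, C3) ∞ CP3 := by
  refine isManifold_of_contDiffOn _ _ _ ?_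
  rintro _ _ ⟨A, rfl⟩ ⟨B, rfl⟩
  have h : ContDiffOn ℂ ω (fun z : C3 => ratio (B.symm (A (affineEmb z))))
      {z | (B.symm (A (affineEmb z))) 0 ≠ 0} :=
    contDiffOn_ratio.comp ((B.symm.contDiff.comp (A.contDiff.comp contDiff_affineEmb)).contDiffOn)
      fun z hz => hz
  refine (((h.restrict_scalars ℝ).of_le le_top).congr ?_).mono ?_
  · intro z hz
    obtain ⟨c, hc, e⟩ := exists_rep_hopf (v := A (affineEmb z)) (by simpa using affineEmb_ne_zero z)
    change ratio (B.symm (hopf (A (affineEmb z))).rep) = _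
    rw [e, map_smul, ratio_smul hc]
  · rintro z ⟨⟨-, hz⟩, -⟩
    obtain ⟨c, hc, e⟩ := exists_rep_hopf (v := A (affineEmb z)) (by simpa using affineEmb_ne_zero z)
    have hz' : (B.symm (hopf (A (affineEmb z))).rep) 0 ≠ 0 := hz
    rw [e, map_smul] at hz'
    intro h0
    exact hz' (by simp [h0])

/-! ### The Kähler and the nearly Kähler structure -/

/-- The tangent space `TangentSpace 𝓘(ℝ, C3) x`, which is by definition the model space: a tangent
vector is given by its components in the preferred chart at `x`. -/
abbrev T (_x : CP3) : Type := C3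

/-- A unit vector that represents `x`; nothing below depends on the choice. -/
def unitRep (x : CP3) : C4 := frame x (affineEmb 0)

/-- The differential of the Hopf fibration at `p = unitRep x ∈ S⁷`. -/
def dHopf (x : CP3) : C4 →L[ℝ] T x := mfderiv 𝓘(ℝ, C4) 𝓘(ℝ, C3) hopf (unitRep x)

/-- The horizontal space at `p = unitRep x`: the vectors that are Hermitian orthogonal to `p`, i.e.
the tangent vectors of `S⁷` at `p` orthogonal to `i p`. -/
def horizontal (x : CP3) : Submodule ℝ C4 := (ℂ ∙ unitRep x)ᗮ.restrictScalars ℝ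

/-- The horizontal lift of tangent vectors at `x`: the inverse of the differential of the Hopf
fibration restricted to the horizontal space. -/
def hlift (x : CP3) : T x →L[ℝ] C4 :=
  (horizontal x).subtypeL ∘L ((dHopf x) ∘L (horizontal x).subtypeL).inverse

/-- The Fubini-Study metric `g_∘`, for which the Hopf fibration is a Riemannian submersion. -/
def fsMetric (x : CP3) : T x →L[ℝ] T x →L[ℝ] ℝ :=
  ContinuousLinearMap.bilinearComp (innerSL ℝ) (hlift x) (hlift x)

/-- The standard complex structure `J_∘`, induced by multiplication by `i`. -/
def J₀ (x : CP3) : T x →L[ℝ] T x :=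
  dHopf x ∘L (Complex.I • ContinuousLinearMap.id ℝ C4) ∘L hlift x

/-- The orthogonal projection of `ℂ⁴` onto `ℂ · j p = span_ℝ {j p, k p}`, for a unit vector `p`. -/
def vertProj (p : C4) : C4 →L[ℝ] C4 :=
  ((innerSL ℂ (quatJ p)).smulRight (quatJ p)).restrictScalars ℝ

/-- The almost product structure `P`: it is `-1` on `𝒟₁²`, the image of `span {j p, k p}`, and `+1` on
its orthogonal complement `𝒟₂⁴`. -/
def P (x : CP3) : T x →L[ℝ] T x :=
  dHopf x ∘L (ContinuousLinearMap.id ℝ C4 - (2 : ℝ) • vertProj (unitRep x)) ∘L hlift x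

/-- The nearly Kähler almost complex structure `J = P J_∘`. -/
def J (x : CP3) : T x →L[ℝ] T x := P x ∘L J₀ x

/-- The nearly Kähler metric `g(X, Y) = 3/2 g_∘(X, Y) + 1/2 g_∘(X, P Y)`. -/
def nkMetric (x : CP3) : T x →L[ℝ] T x →L[ℝ] ℝ :=
  (3 / 2 : ℝ) • fsMetric x + (1 / 2 : ℝ) •
    ContinuousLinearMap.bilinearComp (fsMetric x) (ContinuousLinearMap.id ℝ (T x)) (P x)

/-! ### The Levi-Civita connection in charts, and `G = ∇J` -/

/-- The differential at `y` of the inverse of the preferred chart at `x`. -/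
def dParam (x : CP3) (y : C3) : C3 →L[ℝ] T ((chartAt C3 x).symm y) :=
  mfderiv 𝓘(ℝ, C3) 𝓘(ℝ, C3) (chartAt C3 x).symm y

/-- The metric `g` read in the preferred chart at `x`. -/
def metricInChart (x : CP3) (y : C3) : C3 →L[ℝ] C3 →L[ℝ] ℝ :=
  ContinuousLinearMap.bilinearComp (nkMetric ((chartAt C3 x).symm y)) (dParam x y) (dParam x y)

/-- `J` read in the preferred chart at `x`. -/
def JInChart (x : CP3) (y : C3) : C3 →L[ℝ] C3 :=
  (dParam x y).inverse ∘L J ((chartAt C3 x).symm y) ∘L dParam x y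

/-- The Christoffel symbol `Γ_y(u, v)` of the Levi-Civita connection of `g` in the preferred chart at
`x`, given by `2 g_y(Γ_y(u, v), w) = (∂_u g)(v, w) + (∂_v g)(u, w) - (∂_w g)(u, v)`. -/
def christoffel (x : CP3) (y u v : C3) : C3 :=
  let D := fderiv ℝ (metricInChart x) y
  (metricInChart x y).inverse ((1 / 2 : ℝ) • (D u v + D v u - (D.flip u).flip v))

/-- `G(u, v) = (∇_u J) v`, where `∇` is the Levi-Civita connection of `g`, computed in the preferred
chart at `x` as `(∂_u J) v + Γ(u, J v) - J Γ(u, v)`. -/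
def G (x : CP3) (u v : T x) : T x :=
  let y : C3 := chartAt C3 x x
  fderiv ℝ (JInChart x) y u v + christoffel x y u (JInChart x y v)
    - JInChart x y (christoffel x y u v)

/-! ### Adapted frames and the three normal forms of `J_∘` -/

/-- `U`, `V` are orthonormal for `g`. -/
def IsOrthonormalPair (x : CP3) (U V : T x) : Prop :=
  nkMetric x U U = 1 ∧ nkMetric x V V = 1 ∧ nkMetric x U V = 0

/-- The six vectors `U, V, JU, JV, G(U,V), JG(U,V)`. -/
def adaptedFrame (x : CP3) (U V : T x) : Fin 6 → T x :=
  ![U, V, J x U, J x V, G x U V, J x (G x U V)]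

/-- `U, V, JU, JV, G(U,V), JG(U,V)` is a `g`-orthonormal frame of the tangent space of `ℂP³`. -/
def IsAdaptedFrame (x : CP3) (U V : T x) : Prop :=
  ∀ i k, nkMetric x (adaptedFrame x U V i) (adaptedFrame x U V k) = if i = k then 1 else 0

/-- `J_∘ U` and `J_∘ V` have the coefficients `b₁, b₂, b₄, b₅, c₃, c₄, c₅` (and `b₃ = 0`) with respect
to the frame `U, V, JU, JV, G(U,V), JG(U,V)`. -/
def HasCoefficients (x : CP3) (U V : T x) (b₁ b₂ b₄ b₅ c₃ c₄ c₅ : ℝ) : Prop :=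
  J₀ x U = b₁ • V + b₂ • J x U + b₄ • G x U V + b₅ • J x (G x U V) ∧
  J₀ x V = -b₁ • U + c₃ • J x V + c₄ • G x U V + c₅ • J x (G x U V)

/-- The normal form of Type 0 with parameters `l` (for `λ`), `α`, `θ`. The parameters
`λ = ±1, α = 0` are left out: up to a rotation and a reflection of `U, V` they give Type 1. -/
def Type0 (x : CP3) (U V : T x) (l α θ : ℝ) : Prop :=
  α ∈ Set.Ioo (-(Real.pi / 2)) (Real.pi / 2) ∧ ¬ (l ^ 2 = 1 ∧ α = 0) ∧
  HasCoefficients x U V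
    (l / (1 + l ^ 2) * (1 - Real.sin α))
    ((l ^ 2 + Real.sin α) / (1 + l ^ 2))
    (Real.cos α * Real.sin θ / √(1 + l ^ 2))
    (Real.cos α * Real.cos θ / √(1 + l ^ 2))
    ((1 + l ^ 2 * Real.sin α) / (1 + l ^ 2))
    (l * Real.cos α * Real.cos θ / √(1 + l ^ 2))
    (-(l * Real.cos α * Real.sin θ / √(1 + l ^ 2)))

/-- The normal form of Type 1. -/
def Type1 (x : CP3) (U V : T x) : Prop :=
  HasCoefficients x U V (1 / 2) (1 / 2) (1 / √2) 0 (1 / 2) 0 (-(1 / √2))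

/-- The normal form of Type 2 with parameter `α`. -/
def Type2 (x : CP3) (U V : T x) (α : ℝ) : Prop :=
  HasCoefficients x U V (Real.cos α) (Real.sin α) 0 0 (-Real.sin α) 0 0

/-! ### Totally real surfaces -/

/-- The model space `ℝ²` of surfaces. -/
abbrev E2 : Type := EuclideanSpace ℝ (Fin 2)

section Surface

variable {M : Type*} [TopologicalSpace M] [ChartedSpace E2 M] [IsManifold 𝓘(ℝ, E2) ∞ M]

/-- The differential of `f : M → ℂP³` at `q`. -/
def push (f : M → CP3) (q : M) (u : TangentSpace 𝓘(ℝ, E2) q) : T (f q) :=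
  mfderiv 𝓘(ℝ, E2) 𝓘(ℝ, C3) f q u

/-- `f : M → ℂP³` is a totally real immersed surface of the nearly Kähler `ℂP³`: a smooth immersion
such that `J` maps tangent vectors of the surface to normal vectors. -/
structure IsTotallyReal (f : M → CP3) : Prop where
  smooth : ContMDiff 𝓘(ℝ, E2) 𝓘(ℝ, C3) ∞ f
  immersion : ∀ q, Function.Injective (push f q)
  totallyReal : ∀ q u v, nkMetric (f q) (push f q u) (J (f q) (push f q v)) = 0

/-- The vector field `u` on `M` is smooth on `N`. -/
def SmoothFieldOn (N : Set M) (u : ∀ q : M, TangentSpace 𝓘(ℝ, E2) q) : Prop :=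
  ContMDiffOn 𝓘(ℝ, E2) 𝓘(ℝ, E2).tangent ∞ (fun q => (⟨q, u q⟩ : TangentBundle 𝓘(ℝ, E2) M)) N

/-- The real function `a` on `M` is smooth on `N`. -/
def SmoothFunOn (N : Set M) (a : M → ℝ) : Prop :=
  ContMDiffOn 𝓘(ℝ, E2) 𝓘(ℝ, ℝ) ∞ a N

/-- At the point `q`, some orthonormal frame of the surface puts `J_∘` into the form of Type 0. -/
def IsType0At (f : M → CP3) (q : M) : Prop :=
  ∃ u v, IsOrthonormalPair (f q) (push f q u) (push f q v) ∧
    ∃ l α θ, Type0 (f q) (push f q u) (push f q v) l α θ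

/-- At the point `q`, some orthonormal frame of the surface puts `J_∘` into the form of Type 1. -/
def IsType1At (f : M → CP3) (q : M) : Prop :=
  ∃ u v, IsOrthonormalPair (f q) (push f q u) (push f q v) ∧
    Type1 (f q) (push f q u) (push f q v)

/-- At the point `q`, some orthonormal frame of the surface puts `J_∘` into the form of Type 2. -/
def IsType2At (f : M → CP3) (q : M) : Prop :=
  ∃ u v, IsOrthonormalPair (f q) (push f q u) (push f q v) ∧
    ∃ α, Type2 (f q) (push f q u) (push f q v) α

end Surface

end
end CP3

namespace CP3
noncomputable section

/-! The preferred chart at a point is built from an element of `Sp(2)`. At its centre a tangent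
vector is a triple `w ∈ ℂ³`, and `𝒟₁²` is the line of the coordinate `w 0`. There `J_∘` is `i`, `P`
is `diag(-1, 1, 1)`, `J` is `diag(-i, i, i)`, and `g` is `|w 0|² + 2 (|w 1|² + |w 2|²)`. The metric
and `J` are rational expressions in the chart, so their first derivatives at the centre give the
Christoffel symbols and show that `G` is a complex cross product (`G_apply`).

An orthonormal frame `U, V` of a totally real plane is therefore a unitary pair for the Hermitian
form `hermJ`, and `G(U, V)` completes it to a unitary basis. Since `J_∘` and `J` differ only on the
coordinate `w 0`, all coefficients of `J_∘` are determined by the first components `a, b, c` of `U,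
V, G(U, V)`. These form a unit vector of `ℂ³` (`IsUnitaryPair.column`,
`IsUnitaryPair.hasCoefficients`), defined up to a common phase.

What remains is to normalise `(a, b, c)` under phases and under `O(2)` acting on `(a, b)`, with `c`
multiplied by the determinant. If `a² + b² ≠ 0`, a phase makes it positive and a rotation to the
axes of an ellipse gives `a = r`, `b = i t`, `|t| < r`. If `a² + b² = 0`, then `b = ± i a`, and a
reflection leads to `t = r`. Type 2 is `c = 0`, Type 1 is `t = r` with `|c|² = 1/2`, and Type 0 is
the rest, with `λ = t / r`, `sin α = 2 |c|² - 1` and `θ = -arg (-c)` modulo `2π`.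

The case `a = b = 0` cannot persist on a nonempty open set: the surface would be tangent to the
kernel of the contact form, so the differential of that form would vanish on it, forcing `c = 0` as
well (`IsFrameData.exists_ne_zero`). Each remaining alternative is either an open condition or an
identity, so every nonempty open set contains a smaller one that carries a normal form. This gives
the dense set.

The types are separated by the trace and determinant of the form `g(J_∘ X, J Y)` on the tangent
plane, which is diagonal with entries `b₂, c₃` in a frame of any of the three types
(`trace_det_eq`). -/

/-- The last three coordinates of a vector of `ℂ⁴`. -/
def tail : C4 →L[ℂ] C3 :=
  LinearMap.toContinuousLinearMap
    { toFun := fun v => !₂[v 1, v 2, v 3]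
      map_add' := fun v w => by ext i; fin_cases i <;> simp
      map_smul' := fun c v => by ext i; fin_cases i <;> simp }

/-- `w ↦ (0, w)`. -/
def pad : C3 →L[ℂ] C4 :=
  LinearMap.toContinuousLinearMap
    { toFun := fun w => !₂[0, w 0, w 1, w 2]
      map_add' := fun v w => by ext i; fin_cases i <;> simp
      map_smul' := fun c v => by ext i; fin_cases i <;> simp }

@[simp] theorem tail_zero' (v : C4) : tail v 0 = v 1 := rfl
@[simp] theorem tail_one' (v : C4) : tail v 1 = v 2 := rfl
@[simp] theorem tail_two' (v : C4) : tail v 2 = v 3 := rfl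
@[simp] theorem pad_zero' (v : C3) : pad v 0 = 0 := rfl
@[simp] theorem pad_one' (v : C3) : pad v 1 = v 0 := rfl
@[simp] theorem pad_two' (v : C3) : pad v 2 = v 1 := rfl
@[simp] theorem pad_three' (v : C3) : pad v 3 = v 2 := rfl
@[simp] theorem tail_pad (w : C3) : tail (pad w) = w := by
  ext i; fin_cases i <;> rfl
theorem pad_tail {v : C4} (hv : v 0 = 0) : pad (tail v) = v := by
  ext i; fin_cases i <;> simp [hv]
theorem affineEmb_eq (z : C3) : affineEmb z = affineEmb 0 + pad z := by
  ext i; fin_cases i <;> simp [affineEmb]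

@[simp] theorem affineEmb_zero' (z : C3) : affineEmb z 0 = 1 := rfl
@[simp] theorem affineEmb_one' (z : C3) : affineEmb z 1 = z 0 := rfl
@[simp] theorem affineEmb_two' (z : C3) : affineEmb z 2 = z 1 := rfl
@[simp] theorem affineEmb_three' (z : C3) : affineEmb z 3 = z 2 := rfl
@[simp] theorem quatJ_zero' (v : C4) : quatJ v 0 = -star (v 1) := rfl
@[simp] theorem quatJ_one' (v : C4) : quatJ v 1 = star (v 0) := rfl
@[simp] theorem quatJ_two' (v : C4) : quatJ v 2 = -star (v 3) := rfl
@[simp] theorem quatJ_three' (v : C4) : quatJ v 3 = star (v 2) := rfl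

/-! ### Differentials of the coordinate maps, and the structure tensors at the centre of a chart. -/

theorem hasFDerivAt_affineEmb (y : C3) : HasFDerivAt affineEmb (pad.restrictScalars ℝ) y := by
  have h : affineEmb = fun z => affineEmb 0 + pad z := funext affineEmb_eq
  rw [h]
  exact ((pad.restrictScalars ℝ).hasFDerivAt).const_add _

/-- The differential of `ratio` at `c e₀`. -/
theorem hasFDerivAt_ratio {c : ℂ} (hc : c ≠ 0) :
    HasFDerivAt ratio ((c⁻¹ • tail).restrictScalars ℝ) (c • affineEmb 0) := by
  have hd : DifferentiableAt ℂ ratio (c • affineEmb 0) := by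
    refine (contDiffOn_ratio.contDiffAt ?_).differentiableAt (by simp)
    exact (isOpen_ne_fun (by fun_prop) continuous_const).mem_nhds (by simpa using hc)
  have h1 : HasFDerivAt (𝕜 := ℂ) ratio (c⁻¹ • tail) (c • affineEmb 0) := by
    have hp : ∀ i : Fin 4, HasFDerivAt (𝕜 := ℂ) (fun v : C4 => v i)
        (EuclideanSpace.proj i : C4 →L[ℂ] ℂ) (c • affineEmb 0) := fun i =>
      (EuclideanSpace.proj i : C4 →L[ℂ] ℂ).hasFDerivAt
    have hq : ∀ i : Fin 4, (affineEmb 0) i = if i = 0 then 1 else 0 := fun i => by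
      fin_cases i <;> simp
    have hi : ∀ i : Fin 4, i ≠ 0 → HasFDerivAt (𝕜 := ℂ) (fun v : C4 => v i / v 0)
        (c⁻¹ • (EuclideanSpace.proj i : C4 →L[ℂ] ℂ)) (c • affineEmb 0) := fun i hi => by
      -- The numerator `v i` vanishes at `c e₀`, so only its own derivative survives in the quotient
      -- rule.
      have h0 : (c • affineEmb 0 : C4) 0 ≠ 0 := by simpa using hc
      refine ((hp i).mul (HasDerivAt.comp_hasFDerivAt (c • affineEmb 0 : C4) (hasDerivAt_inv h0) (hp 0))).congr_fderiv ?_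
      ext v
      simp [hq, hi]
    refine hasFDerivWithinAt_univ.1 (hasFDerivWithinAt_euclidean.2 fun i => ?_)
    rw [hasFDerivWithinAt_univ]
    fin_cases i
    · exact hi 1 (by decide)
    · exact hi 2 (by decide)
    · exact hi 3 (by decide)
  exact h1.restrictScalars ℝ

theorem chartAt_apply (x x' : CP3) : chartAt C3 x x' = ratio ((frame x).symm x'.rep) := rfl
theorem chartAt_hopf (x : CP3) {v : C4} (hv : v ≠ 0) :
    chartAt C3 x (hopf v) = ratio ((frame x).symm v) := by
  obtain ⟨c, hc, h⟩ := exists_rep_hopf hv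
  rw [chartAt_apply, h, map_smul, ratio_smul hc]

theorem frame_quatJ (x : CP3) (v : C4) : frame x (quatJ v) = quatJ (frame x v) :=
  (exists_frame x).choose_spec.1 v

theorem frame_symm_quatJ (x : CP3) (v : C4) :
    (frame x).symm (quatJ v) = quatJ ((frame x).symm v) := by
  apply (frame x).injective
  rw [frame_quatJ]; simp

theorem chartAt_self (x : CP3) : chartAt C3 x x = 0 := by
  have h := hopf_frame x
  have h2 := chartAt_hopf x (v := frame x (affineEmb 0)) (by simpa using affineEmb_ne_zero 0)
  rw [h] at h2
  rw [h2]
  simp only [LinearIsometryEquiv.symm_apply_apply]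
  exact ratio_affineEmb 0

theorem unitRep_ne_zero (x : CP3) : unitRep x ≠ 0 := by
  simpa [unitRep] using affineEmb_ne_zero 0

/-- The manifold derivative of a map from a vector space to `ℂP³`. -/
theorem hasMFDerivAt_of_chart {E : Type*} [NormedAddCommGroup E] [NormedSpace ℝ E] {h : E → CP3}
    {p : E} {L : E →L[ℝ] C3} (hc : ContinuousAt h p)
    (hd : HasFDerivAt (fun v => (chartAt C3 (h p) (h v) : C3)) L p) :
    HasMFDerivAt 𝓘(ℝ, E) 𝓘(ℝ, C3) h p L :=
  ⟨hc, hd.hasFDerivWithinAt⟩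

theorem mfderiv_eq_of_chart {E : Type*} [NormedAddCommGroup E] [NormedSpace ℝ E] {h : E → CP3}
    {p : E} {L : E →L[ℝ] C3} (hc : ContinuousAt h p)
    (hd : HasFDerivAt (fun v => (chartAt C3 (h p) (h v) : C3)) L p) :
    mfderiv 𝓘(ℝ, E) 𝓘(ℝ, C3) h p = L :=
  (hasMFDerivAt_of_chart hc hd).mfderiv

theorem dHopf_apply (x : CP3) (v : C4) : dHopf x v = tail ((frame x).symm v) := by
  have hx : hopf (unitRep x) = x := hopf_frame x
  have hn : ∀ᶠ v in 𝓝 (unitRep x), v ≠ 0 := isOpen_ne.mem_nhds (unitRep_ne_zero x)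
  have hc : ContinuousAt hopf (unitRep x) := continuousOn_hopf.continuousAt hn
  have hd : HasFDerivAt (fun v : C4 => ratio ((frame x).symm v))
      ((((1:ℂ)⁻¹ • tail).restrictScalars ℝ) ∘L
        ((frame x).symm.toContinuousLinearEquiv.restrictScalars ℝ : C4 →L[ℝ] C4)) (unitRep x) := by
    have h1 : HasFDerivAt ratio (((1:ℂ)⁻¹ • tail).restrictScalars ℝ)
        ((frame x).symm (unitRep x)) := by
      convert hasFDerivAt_ratio one_ne_zero using 1
      simp [unitRep]
    exact h1.comp (unitRep x)
      ((frame x).symm.toContinuousLinearEquiv.restrictScalars ℝ : C4 →L[ℝ] C4).hasFDerivAt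
  rw [dHopf, mfderiv_eq_of_chart hc (L := (((1:ℂ)⁻¹ • tail).restrictScalars ℝ) ∘L
        ((frame x).symm.toContinuousLinearEquiv.restrictScalars ℝ : C4 →L[ℝ] C4))]
  · simp
  · rw [hx]
    exact hd.congr_of_eventuallyEq (hn.mono fun v hv => chartAt_hopf x hv)

theorem hlift_apply (x : CP3) (w : T x) : hlift x w = frame x (pad w) := by
  have hmem : ∀ v : C4, v ∈ horizontal x ↔ (frame x).symm v 0 = 0 := fun v => by
    rw [horizontal, Submodule.restrictScalars_mem, Submodule.mem_orthogonal_singleton_iff_inner_right,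
      unitRep, ← (frame x).symm.inner_map_map]
    simp [PiLp.inner_apply, Fin.sum_univ_four]
  have h0 : ∀ w : C3, frame x (pad w) ∈ horizontal x := fun w => by simp [hmem]
  set g : C3 →L[ℝ] horizontal x := ContinuousLinearMap.codRestrict
    (((frame x).toContinuousLinearEquiv.restrictScalars ℝ : C4 →L[ℝ] C4) ∘L
      pad.restrictScalars ℝ) (horizontal x) h0 with hg
  have hgv : ∀ w, (g w : C4) = frame x (pad w) := fun w => rfl
  -- `ContinuousLinearMap.inverse` is zero on maps that are not invertible, so a two-sided inverse
  -- has to be exhibited.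
  have hi : ((dHopf x) ∘L (horizontal x).subtypeL).inverse = g := by
    apply ContinuousLinearMap.inverse_eq
    · ext1 w
      change dHopf x (g w) = w
      rw [dHopf_apply, hgv]; simp
    · ext1 v
      apply Subtype.ext
      change (g (dHopf x v) : C4) = v
      rw [hgv, dHopf_apply, pad_tail ((hmem v).1 v.2)]; simp
  rw [hlift, hi]
  exact hgv w

theorem J₀_apply (x : CP3) (w : T x) : J₀ x w = Complex.I • w := by
  change dHopf x (Complex.I • hlift x w) = _
  rw [dHopf_apply, hlift_apply, map_smul, map_smul]
  simp

theorem real_inner_C4 (v w : C4) : inner ℝ v w = (⟪v, w⟫_ℂ).re := by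
  simp [PiLp.inner_apply, Fin.sum_univ_four, Complex.inner]

theorem fsMetric_apply (x : CP3) (u v : T x) :
    fsMetric x u v = (star (u 0) * v 0 + star (u 1) * v 1 + star (u 2) * v 2).re := by
  change inner ℝ (hlift x u) (hlift x v) = _
  rw [hlift_apply, hlift_apply, real_inner_C4, LinearIsometryEquiv.inner_map_map]
  simp [PiLp.inner_apply, Fin.sum_univ_four]
  ring

/-- The frame commutes with `quatJ`, hence sends `e₁ = quatJ e₀` to `j p`; so `𝒟₁²` is exactly the
first coordinate line. -/
theorem P_apply (x : CP3) (w : T x) : P x w = !₂[-w 0, w 1, w 2] := by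
  change dHopf x (hlift x w - (2 : ℝ) • vertProj (unitRep x) (hlift x w)) = _
  have h : vertProj (unitRep x) (hlift x w) = frame x (w 0 • quatJ (affineEmb 0)) := by
    change ⟪quatJ (unitRep x), hlift x w⟫_ℂ • quatJ (unitRep x) = _
    rw [hlift_apply, unitRep, ← frame_quatJ, LinearIsometryEquiv.inner_map_map, map_smul]
    simp [PiLp.inner_apply, Fin.sum_univ_four]
  rw [h, dHopf_apply, hlift_apply, map_sub, LinearIsometryEquiv.symm_apply_apply,
    ← Complex.coe_smul, map_smul, LinearIsometryEquiv.symm_apply_apply]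
  ext i; fin_cases i <;> simp
  ring

theorem J_apply (x : CP3) (w : T x) :
    J x w = !₂[-(Complex.I * w 0), Complex.I * w 1, Complex.I * w 2] := by
  change P x (J₀ x w) = _
  rw [P_apply, J₀_apply]
  rfl

theorem nkMetric_apply (x : CP3) (u v : T x) :
    nkMetric x u v = (star (u 0) * v 0 + 2 * (star (u 1) * v 1 + star (u 2) * v 2)).re := by
  change (3 / 2 : ℝ) * fsMetric x u v + (1 / 2 : ℝ) * fsMetric x u (P x v) = _
  rw [P_apply, fsMetric_apply, fsMetric_apply]
  simp
  ring

/-! ### The structure in an affine chart -/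

/-- `|(1, y)|²`. -/
def normSqEmb (y : C3) : ℝ :=
  1 + Complex.normSq (y 0) + Complex.normSq (y 1) + Complex.normSq (y 2)

/-- The Hermitian product of `(1, y)` and `(0, v)`. -/
def radial (y v : C3) : ℂ := star (y 0) * v 0 + star (y 1) * v 1 + star (y 2) * v 2

/-- The holomorphic contact form `dy₀ - y₂ dy₁ + y₁ dy₂`, whose kernel is `𝒟₂⁴`. -/
def contact (y v : C3) : ℂ := v 0 - y 2 * v 1 + y 1 * v 2

/-- `v₁ w₂ - v₂ w₁`. -/
def area (v w : C3) : ℂ := v 1 * w 2 - v 2 * w 1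

/-- The Hermitian product of `ℂ³`. -/
def herm (v w : C3) : ℂ := star (v 0) * w 0 + star (v 1) * w 1 + star (v 2) * w 2

/-- The vector `quatJ (1, y)` projected to the chart. -/
def quatDir (y : C3) : C3 :=
  !₂[1 + (Complex.normSq (y 0) : ℂ), -star (y 2) + y 1 * star (y 0),
    star (y 1) + y 2 * star (y 0)]

/-- The symplectic form of `ℍ²`. -/
def sympl (v w : C4) : ℂ := v 0 * w 1 - v 1 * w 0 + v 2 * w 3 - v 3 * w 2

theorem normSqEmb_pos (y : C3) : 0 < normSqEmb y := by
  have h := fun i => Complex.normSq_nonneg (y i)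
  have := h 0; have := h 1; have := h 2
  unfold normSqEmb; linarith

theorem inner_C4 (v w : C4) : ⟪v, w⟫_ℂ =
    star (v 0) * w 0 + star (v 1) * w 1 + star (v 2) * w 2 + star (v 3) * w 3 := by
  simp [PiLp.inner_apply, Fin.sum_univ_four]; ring

theorem sympl_eq (v w : C4) : sympl v w = ⟪quatJ v, w⟫_ℂ := by
  rw [inner_C4]; simp [sympl]; ring

theorem quatJ_smul (c : ℂ) (v : C4) : quatJ (c • v) = star c • quatJ v := by
  ext i; fin_cases i <;> simp

/-- The passage from the preferred chart at `x` to the preferred chart at the point with coordinate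
`y`, in terms of an element of `Sp(2)` that maps `(1, y)` to `c e₀`. -/
theorem exists_transition (x : CP3) (y : C3) : ∃ (C : C4 ≃ₗᵢ[ℂ] C4) (c : ℂ),
    (∀ v, C (quatJ v) = quatJ (C v)) ∧ C (affineEmb y) = c • affineEmb 0 ∧
    c ≠ 0 ∧ c * star c = normSqEmb y ∧
    (∀ v, dParam x y v = c⁻¹ • tail (C (pad v))) ∧
    HasMFDerivAt 𝓘(ℝ, C3) 𝓘(ℝ, C3) (chartAt C3 x).symm y (dParam x y) := by
  set x' := (chartAt C3 x).symm y with hx'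
  have hA0 : ∀ z, frame x (affineEmb z) ≠ 0 := fun z => by simpa using affineEmb_ne_zero z
  have hmk : hopf (frame x' (affineEmb 0)) = hopf (frame x (affineEmb y)) := by
    rw [hopf_frame]; rfl
  have hB0 : frame x' (affineEmb 0) ≠ 0 := by simpa using affineEmb_ne_zero 0
  -- Both vectors represent the point with coordinate `y`. The factor `c` depends on the arbitrary
  -- choice of frames and need not vary continuously.
  obtain ⟨c, hc⟩ : ∃ c : ℂ, c • frame x' (affineEmb 0) = frame x (affineEmb y) := by
    rw [hopf_of_ne hB0, hopf_of_ne (hA0 y), eq_comm, Projectivization.mk_eq_mk_iff'] at hmk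
    exact hmk
  have hc0 : c ≠ 0 := by
    rintro rfl
    exact hA0 y (by rw [← hc, zero_smul])
  set C : C4 ≃ₗᵢ[ℂ] C4 := (frame x).trans (frame x').symm with hC
  have hCv : ∀ v, C v = (frame x').symm (frame x v) := fun v => rfl
  have hCy : C (affineEmb y) = c • affineEmb 0 := by
    rw [hCv, ← hc, map_smul, LinearIsometryEquiv.symm_apply_apply]
  have hcont : ContinuousAt (chartAt C3 x).symm y :=
    (chartAt C3 x).symm.continuousAt (Set.mem_univ _)
  have hd : HasFDerivAt (fun z => (chartAt C3 x' ((chartAt C3 x).symm z) : C3))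
      (((c⁻¹ • tail).restrictScalars ℝ) ∘L
        (C.toContinuousLinearEquiv.restrictScalars ℝ : C4 →L[ℝ] C4) ∘L pad.restrictScalars ℝ) y := by
    have h1 : HasFDerivAt ratio ((c⁻¹ • tail).restrictScalars ℝ) (C (affineEmb y)) := by
      rw [hCy]; exact hasFDerivAt_ratio hc0
    have h2 : HasFDerivAt (fun z => C (affineEmb z))
        ((C.toContinuousLinearEquiv.restrictScalars ℝ : C4 →L[ℝ] C4) ∘L pad.restrictScalars ℝ) y :=
      (C.toContinuousLinearEquiv.restrictScalars ℝ : C4 →L[ℝ] C4).hasFDerivAt.comp y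
        (hasFDerivAt_affineEmb y)
    refine (h1.comp y h2).congr_of_eventuallyEq (Filter.Eventually.of_forall fun z => ?_)
    exact chartAt_hopf x' (hA0 z)
  have hm := hasMFDerivAt_of_chart hcont hd
  have hdp : dParam x y = _ := hm.mfderiv
  refine ⟨C, c, fun v => ?_, hCy, hc0, ?_, fun v => ?_, ?_⟩
  · rw [hCv, hCv, frame_quatJ, frame_symm_quatJ]
  · have h := C.inner_map_map (affineEmb y) (affineEmb y)
    rw [hCy, inner_C4, inner_C4] at h
    simp [normSqEmb] at h ⊢
    simp only [Complex.normSq_eq_conj_mul_self]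
    rw [mul_comm c, h]
  · rw [hdp]; rfl
  · rw [hdp]; exact hm

theorem inner_quatJ_map {C : C4 ≃ₗᵢ[ℂ] C4} (hC : ∀ v, C (quatJ v) = quatJ (C v)) (v w : C4) :
    sympl (C v) (C w) = sympl v w := by
  rw [sympl_eq, sympl_eq, ← hC, LinearIsometryEquiv.inner_map_map]

/-- The components of tangent vectors given in the preferred chart at `x`, with respect to the
preferred chart at the point with coordinate `y`. -/
theorem exists_dParam_apply (x : CP3) (y : C3) : ∃ c : ℂ, c ≠ 0 ∧ c * star c = normSqEmb y ∧
    (∀ v, dParam x y v 0 = contact y v / c ^ 2) ∧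
    (∀ v w, area (dParam x y v) (dParam x y w) =
      (area v w - (radial y v * contact y w - contact y v * radial y w) / normSqEmb y) / c ^ 2) ∧
    (∀ v w, herm (dParam x y v) (dParam x y w) =
      herm v w / normSqEmb y - star (radial y v) * radial y w / normSqEmb y ^ 2) := by
  obtain ⟨C, c, hJ, hCy, hc, hcn, hd, -⟩ := exists_transition x y
  have hsc : star c ≠ 0 := by simpa using hc
  have h0 : ∀ v, C (pad v) 0 = radial y v / star c := fun v => by
    have h := C.inner_map_map (affineEmb y) (pad v)
    rw [hCy, inner_C4, inner_C4] at h
    rw [eq_div_iff hsc]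
    simp [radial] at h ⊢
    rw [← h]; ring
  have h1 : ∀ v, C (pad v) 1 = contact y v / c := fun v => by
    have h := inner_quatJ_map hJ (affineEmb y) (pad v)
    rw [hCy] at h
    rw [eq_div_iff hc]
    simp [sympl, contact] at h ⊢
    rw [mul_comm, h]; ring
  refine ⟨c, hc, hcn, fun v => ?_, fun v w => ?_, fun v w => ?_⟩
  · rw [hd]
    simp [h1]; field_simp
  · have h := inner_quatJ_map hJ (pad v) (pad w)
    simp only [sympl, h0, h1] at h
    rw [hd, hd, ← hcn]
    simp [area] at h ⊢
    field_simp
    field_simp at h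
    linear_combination h
  · have h := C.inner_map_map (pad v) (pad w)
    rw [inner_C4, inner_C4, h0, h0] at h
    rw [hd, hd, ← hcn]
    simp [herm] at h ⊢
    have hsc' : (starRingEnd ℂ) c ≠ 0 := hsc
    field_simp
    field_simp at h
    linear_combination h

theorem dParam_smul (x : CP3) (y : C3) (a : ℂ) (v : C3) :
    dParam x y (a • v) = a • (dParam x y v : C3) := by
  obtain ⟨C, c, -, -, -, -, hd, -⟩ := exists_transition x y
  rw [hd, hd, map_smul, map_smul, map_smul, smul_comm]

/-- A kernel vector would make `(0, v)` proportional to `(1, y)`, which the zeroth coordinate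
forbids. -/
theorem dParam_isInvertible (x : CP3) (y : C3) : (dParam x y).IsInvertible := by
  obtain ⟨C, c, -, hCy, hc, -, hd, -⟩ := exists_transition x y
  have hinj : Function.Injective (dParam x y) := by
    refine (injective_iff_map_eq_zero _).2 fun v hv => ?_
    rw [hd] at hv
    have h1 : tail (C (pad v)) = 0 := by simpa [hc] using hv
    set s := C (pad v) 0 with hs
    have h2 : C (pad v) = s • affineEmb 0 := by
      ext i
      fin_cases i
      · simp [hs]
      · simpa using congrArg (fun w : C3 => w 0) h1
      · simpa using congrArg (fun w : C3 => w 1) h1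
      · simpa using congrArg (fun w : C3 => w 2) h1
    have h3 : pad v = (s / c) • affineEmb y := by
      apply C.injective
      rw [map_smul, hCy, h2, smul_smul, div_mul_cancel₀ _ hc]
    have h4 : s / c = 0 := by simpa using (congrArg (fun w : C4 => w 0) h3).symm
    rw [h4, zero_smul] at h3
    rw [← tail_pad v, h3, map_zero]
  let e : C3 ≃ₗ[ℝ] C3 := LinearEquiv.ofInjectiveEndo (dParam x y : C3 →ₗ[ℝ] C3) hinj
  exact ⟨e.toContinuousLinearEquiv, by ext1 v; rfl⟩

/-- `quatDir y` is `quatJ (1, y)` corrected by a multiple of `(1, y)` to have zeroth coordinate 0,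
so it spans `𝒟₁²` in the chart. This expresses the projection onto `𝒟₁²` without the unknown factor
`c`. -/
theorem dParam_quatDir (x : CP3) (y v : C3) :
    (!₂[dParam x y v 0, 0, 0] : C3) =
      dParam x y ((contact y v / normSqEmb y) • quatDir y) := by
  obtain ⟨C, c, hJ, hCy, hc, hcn, hd, -⟩ := exists_transition x y
  have hsc : star c ≠ 0 := by simpa using hc
  have h1 : C (pad v) 1 = contact y v / c := by
    have h := inner_quatJ_map hJ (affineEmb y) (pad v)
    rw [hCy] at h
    rw [eq_div_iff hc]
    simp [sympl, contact] at h ⊢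
    rw [mul_comm, h]; ring
  have hp : pad (quatDir y) = quatJ (affineEmb y) + star (y 0) • affineEmb y := by
    ext i; fin_cases i <;> simp [quatDir, Complex.normSq_eq_conj_mul_self] <;> ring
  have h2 : C (pad (quatDir y)) = star c • quatJ (affineEmb 0) + (star (y 0) * c) • affineEmb 0 := by
    rw [hp, map_add, map_smul, hJ, hCy, quatJ_smul, smul_smul]
  rw [dParam_smul, hd, hd, h2, ← hcn]
  ext i; fin_cases i <;> simp [h1]
  have hsc' : (starRingEnd ℂ) c ≠ 0 := hsc
  field_simp

theorem nkMetric_eq_herm (x : CP3) (u v : T x) :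
    nkMetric x u v = (2 * herm u v - star (u 0) * v 0).re := by
  rw [nkMetric_apply, herm]; congr 1; ring

theorem metricInChart_apply (x : CP3) (y u v : C3) :
    metricInChart x y u v = 2 * (herm u v).re / normSqEmb y -
      (2 * (star (radial y u) * radial y v).re + (star (contact y u) * contact y v).re) /
        normSqEmb y ^ 2 := by
  obtain ⟨c, hc, hcn, h0, -, hh⟩ := exists_dParam_apply x y
  change nkMetric _ (dParam x y u) (dParam x y v) = _
  have hsc : star c ≠ 0 := by simpa using hc
  have h1 : star (contact y u / c ^ 2) * (contact y v / c ^ 2) =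
      star (contact y u) * contact y v / ((normSqEmb y ^ 2 : ℝ) : ℂ) := by
    rw [Complex.ofReal_pow, ← hcn]
    rw [star_div₀, star_pow]
    field_simp
  rw [nkMetric_eq_herm, hh, h0, h0, h1]
  have h2 : 2 * (herm u v / normSqEmb y - star (radial y u) * radial y v / normSqEmb y ^ 2) -
      star (contact y u) * contact y v / ((normSqEmb y ^ 2 : ℝ) : ℂ) =
      ((2 : ℝ) * herm u v) / (normSqEmb y : ℝ) -
      ((2 : ℝ) * (star (radial y u) * radial y v) + star (contact y u) * contact y v) /
        ((normSqEmb y ^ 2 : ℝ) : ℂ) := by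
    push_cast; ring
  rw [h2, Complex.sub_re, Complex.div_ofReal_re, Complex.div_ofReal_re, Complex.add_re,
    Complex.re_ofReal_mul, Complex.re_ofReal_mul]

/-- At the centre `J` is `i` minus `2 i` times the projection to the first coordinate;
`dParam_quatDir` transports that projection. -/
theorem JInChart_apply (x : CP3) (y v : C3) :
    JInChart x y v = Complex.I • v - (2 * Complex.I * contact y v / normSqEmb y) • quatDir y := by
  have hinv := dParam_isInvertible x y
  change (dParam x y).inverse (J _ (dParam x y v)) = _
  have h : (J _ (dParam x y v) : C3) = dParam x y
      (Complex.I • v - (2 * Complex.I * contact y v / normSqEmb y) • quatDir y) := by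
    have h1 : (2 * Complex.I * contact y v / normSqEmb y) • quatDir y =
        (2 * Complex.I) • ((contact y v / normSqEmb y) • quatDir y) := by
      rw [smul_smul]; congr 1; ring
    rw [map_sub, dParam_smul, h1, dParam_smul, ← dParam_quatDir, J_apply]
    ext i; fin_cases i <;> simp
    ring
  rw [h]
  exact hinv.inverse_apply_self _

/-! ### Smoothness of the metric and of `J` in a chart. -/

section Smooth

variable {E : Type*} [NormedAddCommGroup E] [NormedSpace ℝ E] {n : WithTop ℕ∞} {f g : E → C3}

theorem contDiff_coord (hf : ContDiff ℝ n f) (i : Fin 3) : ContDiff ℝ n fun e => f e i :=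
  contDiff_piLp 2 |>.1 hf i

theorem contDiff_star {f : E → ℂ} (hf : ContDiff ℝ n f) : ContDiff ℝ n fun e => star (f e) :=
  Complex.conjCLE.contDiff.comp hf

theorem contDiff_re {f : E → ℂ} (hf : ContDiff ℝ n f) : ContDiff ℝ n fun e => (f e).re :=
  Complex.reCLM.contDiff.comp hf

theorem contDiff_ofReal {f : E → ℝ} (hf : ContDiff ℝ n f) : ContDiff ℝ n fun e => (f e : ℂ) :=
  Complex.ofRealCLM.contDiff.comp hf

theorem contDiff_normSq {f : E → ℂ} (hf : ContDiff ℝ n f) :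
    ContDiff ℝ n fun e => Complex.normSq (f e) := by
  have : (fun e => Complex.normSq (f e)) = fun e => (star (f e) * f e).re := by
    funext e; simp [Complex.normSq_apply]
  rw [this]
  exact contDiff_re ((contDiff_star hf).mul hf)

theorem contDiff_normSqEmb (hf : ContDiff ℝ n f) : ContDiff ℝ n fun e => normSqEmb (f e) := by
  have h := fun i => contDiff_normSq (contDiff_coord hf i)
  exact ((contDiff_const.add (h 0)).add (h 1)).add (h 2)

theorem contDiff_herm (hf : ContDiff ℝ n f) (hg : ContDiff ℝ n g) :
    ContDiff ℝ n fun e => herm (f e) (g e) := by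
  have h := fun i => (contDiff_star (contDiff_coord hf i)).mul (contDiff_coord hg i)
  exact ((h 0).add (h 1)).add (h 2)

theorem contDiff_radial (hf : ContDiff ℝ n f) (hg : ContDiff ℝ n g) :
    ContDiff ℝ n fun e => radial (f e) (g e) := contDiff_herm hf hg

theorem contDiff_contact (hf : ContDiff ℝ n f) (hg : ContDiff ℝ n g) :
    ContDiff ℝ n fun e => contact (f e) (g e) := by
  have h := contDiff_coord hf
  have h' := contDiff_coord hg
  exact ((h' 0).sub ((h 2).mul (h' 1))).add ((h 1).mul (h' 2))

theorem contDiff_area (hf : ContDiff ℝ n f) (hg : ContDiff ℝ n g) :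
    ContDiff ℝ n fun e => area (f e) (g e) := by
  have h := contDiff_coord hf
  have h' := contDiff_coord hg
  exact ((h 1).mul (h' 2)).sub ((h 2).mul (h' 1))

theorem contDiff_quatDir (hf : ContDiff ℝ n f) : ContDiff ℝ n fun e => quatDir (f e) := by
  have h0 := contDiff_coord hf 0
  have h1 := contDiff_coord hf 1
  have h2 := contDiff_coord hf 2
  refine (contDiff_piLp 2).2 fun i => ?_
  fin_cases i
  · exact contDiff_const.add (contDiff_ofReal (contDiff_normSq h0))
  · exact (contDiff_star h2).neg.add (h1.mul (contDiff_star h0))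
  · exact (contDiff_star h1).add (h2.mul (contDiff_star h0))

end Smooth

theorem contDiff_metricInChart (x : CP3) : ContDiff ℝ ∞ (metricInChart x) := by
  rw [contDiff_clm_apply_iff]
  intro u
  rw [contDiff_clm_apply_iff]
  intro v
  simp only [metricInChart_apply]
  have hi : ContDiff ℝ ∞ fun y : C3 => y := contDiff_id
  have hN := contDiff_normSqEmb hi
  have hr := fun w : C3 => contDiff_radial hi (contDiff_const (c := w))
  have hc := fun w : C3 => contDiff_contact hi (contDiff_const (c := w))
  refine (contDiff_const.div hN fun y => (normSqEmb_pos y).ne').sub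
    (ContDiff.div ?_ (hN.pow 2) fun y => (pow_pos (normSqEmb_pos y) 2).ne')
  exact (contDiff_const.mul (contDiff_re ((contDiff_star (hr u)).mul (hr v)))).add
    (contDiff_re ((contDiff_star (hc u)).mul (hc v)))

theorem contDiff_JInChart (x : CP3) : ContDiff ℝ ∞ (JInChart x) := by
  rw [contDiff_clm_apply_iff]
  intro v
  simp only [JInChart_apply]
  have hi : ContDiff ℝ ∞ fun y : C3 => y := contDiff_id
  have hN := contDiff_normSqEmb hi
  have hc := fun w : C3 => contDiff_contact hi (contDiff_const (c := w))
  refine contDiff_const.sub (ContDiff.fun_smul ?_ (contDiff_quatDir hi))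
  simp only [div_eq_mul_inv]
  refine (contDiff_const.mul (hc v)).mul (ContDiff.inv (contDiff_ofReal hN) fun y => ?_)
  exact_mod_cast (normSqEmb_pos y).ne'

/-! ### First derivatives at the centre, Christoffel symbols and `G`. -/

theorem fderiv_apply_of_line {E F : Type*} [NormedAddCommGroup E] [NormedSpace ℝ E]
    [NormedAddCommGroup F] [NormedSpace ℝ F] {f : E → F} {f' : F} {h : E}
    (hf : DifferentiableAt ℝ f 0) (hd : HasDerivAt (fun t : ℝ => f (t • h)) f' 0) :
    fderiv ℝ f 0 h = f' := by
  have h1 : HasDerivAt (fun t : ℝ => t • h) h 0 := by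
    simpa using (hasDerivAt_id (0 : ℝ)).smul_const h
  have h2 : HasFDerivAt f (fderiv ℝ f 0) ((0 : ℝ) • h) := by
    rw [zero_smul]; exact hf.hasFDerivAt
  exact (h2.comp_hasDerivAt 0 h1).unique hd

theorem hasDerivAt_inv_one_add_sq (k : ℝ) : HasDerivAt (fun t : ℝ => (1 + t ^ 2 * k)⁻¹) 0 0 := by
  have h : HasDerivAt (fun t : ℝ => 1 + t ^ 2 * k) 0 0 := by
    simpa using ((hasDerivAt_pow 2 (0 : ℝ)).mul_const k).const_add 1
  simpa using h.fun_inv (by simp)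

theorem normSqEmb_line (t : ℝ) (h : C3) :
    normSqEmb (t • h) =
      1 + t ^ 2 * (Complex.normSq (h 0) + Complex.normSq (h 1) + Complex.normSq (h 2)) := by
  simp [normSqEmb]; ring

theorem contact_line (t : ℝ) (h u : C3) : contact (t • h) u = u 0 + t * area h u := by
  simp [contact, area]; ring

theorem radial_line (t : ℝ) (h u : C3) : radial (t • h) u = t * radial h u := by
  simp [radial]; ring

theorem quatDir_line (t : ℝ) (h : C3) : quatDir (t • h) =
    !₂[1, 0, 0] + t • !₂[0, -star (h 2), star (h 1)] +
      (t ^ 2) • !₂[(Complex.normSq (h 0) : ℂ), h 1 * star (h 0), h 2 * star (h 0)] := by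
  ext i; fin_cases i <;> (simp [quatDir]; ring_nf; try simp)

/-- First derivatives of the metric at the centre of the preferred chart. -/
theorem fderiv_metricInChart (x : CP3) (h u v : C3) :
    fderiv ℝ (metricInChart x) 0 h u v =
      -(star (u 0) * area h v + star (area h u) * v 0).re := by
  have hF : Differentiable ℝ (metricInChart x) :=
    (contDiff_metricInChart x).differentiable (by simp)
  have h1 : fderiv ℝ (metricInChart x) 0 h u v = fderiv ℝ (fun y => metricInChart x y u v) 0 h := by
    rw [fderiv_clm_apply (hF.clm_apply (differentiable_const u) 0) (differentiableAt_const v),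
      fderiv_clm_apply (hF 0) (differentiableAt_const u)]
    simp
  rw [h1]
  refine fderiv_apply_of_line
    ((hF.clm_apply (differentiable_const u)).clm_apply (differentiable_const v) 0) ?_
  set k := Complex.normSq (h 0) + Complex.normSq (h 1) + Complex.normSq (h 2) with hk
  set A := (herm u v).re with hA
  set R := (star (radial h u) * radial h v).re with hR
  set p := (star (u 0) * v 0).re with hp
  set q := (star (u 0) * area h v + star (area h u) * v 0).re with hq
  set s := (star (area h u) * area h v).re with hs
  -- Along a line through the centre `normSqEmb` is `1 + t² k` and the radial term is quadratic in
  -- `t`; only the cross term `q` of the contact form is of first order.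
  have hf : (fun t : ℝ => metricInChart x (t • h) u v) = fun t =>
      2 * A * (1 + t ^ 2 * k)⁻¹ -
        (2 * (t ^ 2 * R) + (p + t * q + t ^ 2 * s)) * ((1 + t ^ 2 * k)⁻¹ * (1 + t ^ 2 * k)⁻¹) := by
    funext t
    rw [metricInChart_apply, normSqEmb_line, ← hk, contact_line, contact_line, radial_line,
      radial_line, div_eq_mul_inv, div_eq_mul_inv, sq (1 + t ^ 2 * k), mul_inv]
    congr 3
    · simp [hR]; ring
    · simp [hp, hq, hs]; ring
  rw [hf]
  have hi := hasDerivAt_inv_one_add_sq k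
  have hsq : HasDerivAt (fun t : ℝ => t ^ 2) 0 0 := by simpa using hasDerivAt_pow 2 (0 : ℝ)
  have hid : HasDerivAt (fun t : ℝ => t) 1 0 := hasDerivAt_id 0
  have := (hi.const_mul (2 * A)).sub ((((hsq.mul_const R).const_mul 2).add
    (((hid.mul_const q).const_add p).add (hsq.mul_const s))).mul (hi.mul hi))
  refine (this.congr_deriv ?_)
  simp

/-- First derivatives of `J` at the centre of the preferred chart. -/
theorem fderiv_JInChart (x : CP3) (h v : C3) :
    fderiv ℝ (JInChart x) 0 h v =
      -(2 * Complex.I) • !₂[area h v, -(v 0 * star (h 2)), v 0 * star (h 1)] := by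
  have hF : Differentiable ℝ (JInChart x) := (contDiff_JInChart x).differentiable (by simp)
  have h1 : fderiv ℝ (JInChart x) 0 h v = fderiv ℝ (fun y => JInChart x y v) 0 h := by
    rw [fderiv_clm_apply (hF 0) (differentiableAt_const v)]
    simp
  rw [h1]
  refine fderiv_apply_of_line (hF.clm_apply (differentiable_const v) 0) ?_
  set k := Complex.normSq (h 0) + Complex.normSq (h 1) + Complex.normSq (h 2) with hk
  set e0 : C3 := !₂[1, 0, 0]
  set e1 : C3 := !₂[0, -star (h 2), star (h 1)]
  set e2 : C3 := !₂[(Complex.normSq (h 0) : ℂ), h 1 * star (h 0), h 2 * star (h 0)]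
  have hf : (fun t : ℝ => JInChart x (t • h) v) = fun t =>
      Complex.I • v - (1 + t ^ 2 * k)⁻¹ • (((2 * Complex.I * v 0) • (e0 + t • e1 + t ^ 2 • e2)) +
        t • ((2 * Complex.I * area h v) • (e0 + t • e1 + t ^ 2 • e2))) := by
    funext t
    rw [JInChart_apply, normSqEmb_line, ← hk, contact_line, quatDir_line]
    congr 1
    simp only [← Complex.coe_smul, smul_smul, ← add_smul]
    congr 1
    push_cast
    field_simp
  rw [hf]
  have hi := hasDerivAt_inv_one_add_sq k
  have hsq : HasDerivAt (fun t : ℝ => t ^ 2) 0 0 := by simpa using hasDerivAt_pow 2 (0 : ℝ)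
  have hid : HasDerivAt (fun t : ℝ => t) 1 0 := hasDerivAt_id 0
  have hq := ((hid.smul_const e1).const_add e0).add (hsq.smul_const e2)
  have := (hi.smul ((hq.const_smul (2 * Complex.I * v 0)).add
    (hid.smul (hq.const_smul (2 * Complex.I * area h v))))).const_sub (Complex.I • v)
  refine this.congr_deriv ?_
  ext i; fin_cases i <;> simp [e0, e1, e2] <;> ring

theorem metricInChart_zero (x : CP3) (u v : C3) :
    metricInChart x 0 u v = (star (u 0) * v 0 + 2 * (star (u 1) * v 1 + star (u 2) * v 2)).re := by
  rw [metricInChart_apply]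
  simp [normSqEmb, radial, contact, herm]
  ring

theorem metricInChart_zero_isInvertible (x : CP3) : (metricInChart x 0).IsInvertible := by
  have hinj : Function.Injective (metricInChart x 0) := by
    refine (injective_iff_map_eq_zero _).2 fun u hu => ?_
    have h : metricInChart x 0 u u = 0 := by rw [hu]; rfl
    rw [metricInChart_zero] at h
    simp at h
    have h0 : u 0 = 0 ∧ u 1 = 0 ∧ u 2 = 0 := by
      simp only [Complex.ext_iff, Complex.zero_re, Complex.zero_im]
      refine ⟨⟨?_, ?_⟩, ⟨?_, ?_⟩, ?_, ?_⟩ <;> nlinarith [sq_nonneg (u 0).re, sq_nonneg (u 0).im,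
        sq_nonneg (u 1).re, sq_nonneg (u 1).im, sq_nonneg (u 2).re, sq_nonneg (u 2).im]
    ext i; fin_cases i
    · exact h0.1
    · exact h0.2.1
    · exact h0.2.2
  have hfin : Module.finrank ℝ C3 = Module.finrank ℝ (C3 →L[ℝ] ℝ) := by
    rw [← LinearEquiv.finrank_eq (LinearMap.toContinuousLinearMap (𝕜 := ℝ) (E := C3) (F' := ℝ))]
    exact (Subspace.dual_finrank_eq (K := ℝ) (V := C3)).symm
  let e : C3 ≃ₗ[ℝ] (C3 →L[ℝ] ℝ) := LinearEquiv.ofInjectiveOfFinrankEq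
    (metricInChart x 0 : C3 →ₗ[ℝ] (C3 →L[ℝ] ℝ)) hinj hfin
  exact ⟨e.toContinuousLinearEquiv, by ext1 v; rfl⟩

/-- The displayed vector satisfies the Koszul identity against every `w`, and the metric at the
centre is invertible. -/
theorem christoffel_zero (x : CP3) (u v : C3) : christoffel x 0 u v =
    (1 / 2 : ℂ) • !₂[0, v 0 * star (u 2) + u 0 * star (v 2), -(v 0 * star (u 1) + u 0 * star (v 1))] := by
  set Γ : C3 := (1 / 2 : ℂ) •
    !₂[0, v 0 * star (u 2) + u 0 * star (v 2), -(v 0 * star (u 1) + u 0 * star (v 1))] with hΓ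
  have h : (1 / 2 : ℝ) • (fderiv ℝ (metricInChart x) 0 u v + fderiv ℝ (metricInChart x) 0 v u -
      ((fderiv ℝ (metricInChart x) 0).flip u).flip v) = metricInChart x 0 Γ := by
    ext w
    change (1 / 2 : ℝ) * (fderiv ℝ (metricInChart x) 0 u v w + fderiv ℝ (metricInChart x) 0 v u w -
      fderiv ℝ (metricInChart x) 0 w u v) = _
    rw [fderiv_metricInChart, fderiv_metricInChart, fderiv_metricInChart, metricInChart_zero]
    simp [hΓ, area]
    ring
  change (metricInChart x 0).inverse _ = _
  rw [h]
  exact (metricInChart_zero_isInvertible x).inverse_apply_self _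

theorem JInChart_zero (x : CP3) (v : C3) :
    JInChart x 0 v = !₂[-(Complex.I * v 0), Complex.I * v 1, Complex.I * v 2] := by
  rw [JInChart_apply]
  ext i; fin_cases i <;> simp [normSqEmb, contact, quatDir]
  ring

/-- The tensor `G` at the centre of the preferred chart is the complex cross product. -/
theorem G_apply (x : CP3) (u v : T x) : G x u v = Complex.I •
    !₂[-(2 * area u v), v 0 * star (u 2) - u 0 * star (v 2), u 0 * star (v 1) - v 0 * star (u 1)] := by
  change fderiv ℝ (JInChart x) (chartAt C3 x x) u v +
    christoffel x (chartAt C3 x x) u (JInChart x (chartAt C3 x x) v) -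
    JInChart x (chartAt C3 x x) (christoffel x (chartAt C3 x x) u v) = _
  rw [chartAt_self, fderiv_JInChart, christoffel_zero, christoffel_zero, JInChart_zero,
    JInChart_zero]
  ext i; fin_cases i <;> simp [area] <;> ring

/-- `g` as the real part of a Hermitian form for which `J` is skew: `g(u, v) + i g(u, Jv)`. -/
def hermJ (u v : C3) : ℂ := u 0 * star (v 0) + 2 * (star (u 1) * v 1 + star (u 2) * v 2)

/-! ### Adapted frames at a point -/

theorem nkMetric_eq_hermJ (x : CP3) (u v : T x) : nkMetric x u v = (hermJ u v).re := by
  rw [nkMetric_apply]; simp [hermJ]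

theorem hermJ_J_right (x : CP3) (u v : T x) : hermJ u (J x v) = Complex.I * hermJ u v := by
  rw [J_apply]; simp [hermJ]; ring

theorem hermJ_conj (u v : C3) : hermJ u v = star (hermJ v u) := by
  simp [hermJ]; ring

theorem hermJ_J_left (x : CP3) (u v : T x) : hermJ (J x u) v = -(Complex.I * hermJ u v) := by
  rw [hermJ_conj, hermJ_J_right, hermJ_conj u v]; simp

theorem hermJ_G_right (x : CP3) (u v : T x) : hermJ u (G x u v) = 0 ∧ hermJ v (G x u v) = 0 := by
  rw [G_apply]
  constructor <;> · simp [hermJ, area]; ring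

/-- Lagrange's identity for the complex cross product. -/
theorem hermJ_G_self (x : CP3) (u v : T x) :
    hermJ (G x u v) (G x u v) = hermJ u u * hermJ v v - hermJ u v * hermJ v u := by
  rw [G_apply]
  simp only [hermJ, area]
  simp
  linear_combination (-(4 * (u 1 * v 2 - u 2 * v 1) *
    ((starRingEnd ℂ) (u 1) * (starRingEnd ℂ) (v 2) - (starRingEnd ℂ) (u 2) * (starRingEnd ℂ) (v 1)))
    - 2 * ((starRingEnd ℂ) (v 0) * u 2 - (starRingEnd ℂ) (u 0) * v 2) *
      (v 0 * (starRingEnd ℂ) (u 2) - u 0 * (starRingEnd ℂ) (v 2))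
    - 2 * ((starRingEnd ℂ) (u 0) * v 1 - (starRingEnd ℂ) (v 0) * u 1) *
      (u 0 * (starRingEnd ℂ) (v 1) - v 0 * (starRingEnd ℂ) (u 1))) * Complex.I_mul_I

/-- `u`, `v` are orthonormal and span a totally real plane. -/
structure IsUnitaryPair (x : CP3) (u v : T x) : Prop where
  self_left : hermJ u u = 1
  self_right : hermJ v v = 1
  cross : hermJ u v = 0

theorem IsUnitaryPair.of_orthonormal {x : CP3} {u v : T x} (h : IsOrthonormalPair x u v)
    (hJ : nkMetric x u (J x v) = 0) : IsUnitaryPair x u v := by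
  obtain ⟨h1, h2, h3⟩ := h
  rw [nkMetric_eq_hermJ] at h1 h2 h3 hJ
  rw [hermJ_J_right] at hJ
  have hself : ∀ w : C3, (hermJ w w).im = 0 := fun w => by simp [hermJ]; ring
  refine ⟨Complex.ext h1 (hself u), Complex.ext h2 (hself v), Complex.ext h3 ?_⟩
  simpa using hJ

theorem IsUnitaryPair.gram {x : CP3} {u v : T x} (h : IsUnitaryPair x u v) :
    hermJ v u = 0 ∧ hermJ u (G x u v) = 0 ∧ hermJ v (G x u v) = 0 ∧ hermJ (G x u v) u = 0 ∧
      hermJ (G x u v) v = 0 ∧ hermJ (G x u v) (G x u v) = 1 := by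
  have hvu : hermJ v u = 0 := by rw [hermJ_conj, h.cross, star_zero]
  obtain ⟨h1, h2⟩ := hermJ_G_right x u v
  refine ⟨hvu, h1, h2, ?_, ?_, ?_⟩
  · rw [hermJ_conj, h1, star_zero]
  · rw [hermJ_conj, h2, star_zero]
  · rw [hermJ_G_self, h.self_left, h.self_right, h.cross]; ring

theorem IsUnitaryPair.isAdaptedFrame {x : CP3} {u v : T x} (h : IsUnitaryPair x u v) :
    IsAdaptedFrame x u v := by
  obtain ⟨h1, h2, h3, h4, h5, h6⟩ := h.gram
  intro i k
  rw [nkMetric_eq_hermJ]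
  fin_cases i <;> fin_cases k <;>
    simp [adaptedFrame, hermJ_J_left, hermJ_J_right, h.self_left, h.self_right, h.cross, h1, h2, h3,
      h4, h5, h6]

/-- The first components of a unitary frame `u, v, G(u, v)`. -/
theorem IsUnitaryPair.column {x : CP3} {u v : T x} (h : IsUnitaryPair x u v) :
    u 0 * star (u 0) + v 0 * star (v 0) + G x u v 0 * star (G x u v 0) = 1 ∧
    (∀ i : Fin 3, i ≠ 0 → u 0 * u i + v 0 * v i + G x u v 0 * G x u v i = 0) := by
  obtain ⟨h1, h2, h3, h4, h5, h6⟩ := h.gram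
  have ha := h.self_left
  have hb := h.self_right
  have hc := h.cross
  set g : C3 := G x u v
  set A : Matrix (Fin 3) (Fin 3) ℂ := !![star (u 0), u 1, u 2; star (v 0), v 1, v 2;
    star (g 0), g 1, g 2] with hA
  set B : Matrix (Fin 3) (Fin 3) ℂ := !![u 0, v 0, g 0; 2 * star (u 1), 2 * star (v 1), 2 * star (g 1);
    2 * star (u 2), 2 * star (v 2), 2 * star (g 2)] with hB
  -- Orthonormality of the rows. The first coordinate is conjugated because `J` acts on it by `-i`.
  -- Commuting the two factors turns row relations into the column relations that are wanted.
  have hAB : A * B = 1 := by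
    ext i k
    simp only [hermJ] at h1 h2 h3 h4 h5 h6 ha hb hc
    fin_cases i <;> fin_cases k <;> simp [hA, hB, Matrix.mul_apply, Fin.sum_univ_three] at h1 h2 h3 h4 h5 h6 ha hb hc ⊢
    · linear_combination ha
    · linear_combination h1
    · linear_combination h4
    · linear_combination hc
    · linear_combination hb
    · linear_combination h5
    · linear_combination h2
    · linear_combination h3
    · linear_combination h6
  have hBA : B * A = 1 := mul_eq_one_comm.1 hAB
  have e := fun i => congrFun (congrFun hBA 0) i
  have e0 := e 0
  have e1 := e 1
  have e2 := e 2
  simp [hA, hB, Matrix.mul_apply, Fin.sum_univ_three] at e0 e1 e2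
  refine ⟨by simpa using e0, fun i hi => ?_⟩
  fin_cases i
  · exact absurd rfl hi
  · exact e1
  · exact e2

/-- The coefficients of `J_∘` in terms of the first components of the frame. -/
theorem IsUnitaryPair.hasCoefficients {x : CP3} {u v : T x} (h : IsUnitaryPair x u v)
    {b₁ b₂ b₄ b₅ c₃ c₄ c₅ : ℝ}
    (h1 : (b₁ : ℂ) = -2 * Complex.I * (star (u 0) * v 0))
    (h2 : (b₂ : ℂ) = 1 - 2 * (u 0 * star (u 0)))
    (h4 : (b₄ + b₅ * Complex.I : ℂ) = -2 * Complex.I * (star (u 0) * G x u v 0))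
    (h3 : (c₃ : ℂ) = 1 - 2 * (v 0 * star (v 0)))
    (h5 : (c₄ + c₅ * Complex.I : ℂ) = -2 * Complex.I * (star (v 0) * G x u v 0)) :
    HasCoefficients x u v b₁ b₂ b₄ b₅ c₃ c₄ c₅ := by
  obtain ⟨e0, e⟩ := h.column
  have e1 := e 1 (by decide)
  have e2 := e 2 (by decide)
  have h1' := congrArg star h1
  have h4' := congrArg star h4
  have h5' := congrArg star h5
  simp at h1' h4' h5' h1 h2 h3 h4 h5 e0
  rw [HasCoefficients, J₀_apply, J₀_apply, J_apply, J_apply, J_apply]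
  -- Componentwise, this is `J_∘ w = J w + 2 i w₀ e₀` together with the expansion of `e₀` in the
  -- frame given by the column relations.
  constructor
  · ext i; fin_cases i
    · simp
      linear_combination (-v 0) * h1' + Complex.I * u 0 * h2 - G x u v 0 * h4' -
        2 * Complex.I * u 0 * e0
    · simp
      linear_combination (-v 1) * h1 - Complex.I * u 1 * h2 - G x u v 1 * h4 +
        2 * Complex.I * (starRingEnd ℂ) (u 0) * e1
    · simp
      linear_combination (-v 2) * h1 - Complex.I * u 2 * h2 - G x u v 2 * h4 +
        2 * Complex.I * (starRingEnd ℂ) (u 0) * e2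
  · ext i; fin_cases i
    · simp
      linear_combination (u 0) * h1 + Complex.I * v 0 * h3 - G x u v 0 * h5' -
        2 * Complex.I * v 0 * e0
    · simp
      linear_combination (u 1) * h1' - Complex.I * v 1 * h3 - G x u v 1 * h5 +
        2 * Complex.I * (starRingEnd ℂ) (v 0) * e1
    · simp
      linear_combination (u 2) * h1' - Complex.I * v 2 * h3 - G x u v 2 * h5 +
        2 * Complex.I * (starRingEnd ℂ) (v 0) * e2

/-- `g` and `2 g_∘` differ only on the first coordinate, so `g(u, v) = 0` leaves half of its
contribution. -/
theorem IsUnitaryPair.fsMetric_eq {x : CP3} {u v : T x} (h : IsUnitaryPair x u v) :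
    fsMetric x u v = (1 / 2) * (star (u 0) * v 0).re := by
  have := congrArg Complex.re h.cross
  simp [hermJ] at this
  rw [fsMetric_apply]
  simp
  linarith

/-- Pairing `J_∘ X` with `J Y` picks out the coefficients along `JU, JV`, while in coordinates the
result is `g(X, Y) - 2 Re (X̄₀ Y₀)`. The missing `JV` term in `J_∘ U` is what makes `Re (Ū₀ V₀)`
vanish. -/
theorem IsUnitaryPair.eq_of_hasCoefficients {x : CP3} {u v : T x} (h : IsUnitaryPair x u v)
    {b₁ b₂ b₄ b₅ c₃ c₄ c₅ : ℝ} (hc : HasCoefficients x u v b₁ b₂ b₄ b₅ c₃ c₄ c₅) :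
    (star (u 0) * v 0).re = 0 ∧ b₂ = 1 - 2 * Complex.normSq (u 0) ∧
      c₃ = 1 - 2 * Complex.normSq (v 0) := by
  obtain ⟨hu, hv⟩ := hc
  obtain ⟨g1, -, -, g4, g5, -⟩ := h.gram
  have key : ∀ a b : C3, nkMetric x (J₀ x a) (J x b) =
      (hermJ a b).re - 2 * (star (a 0) * b 0).re := fun a b => by
    rw [J₀_apply, J_apply, nkMetric_apply]; simp [hermJ]; ring
  have e1 := key u v
  have e2 := key u u
  have e3 := key v v
  rw [hu, nkMetric_eq_hermJ] at e1 e2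
  rw [hv, nkMetric_eq_hermJ] at e3
  have hadd : ∀ a b w : C3, hermJ (a + b) w = hermJ a w + hermJ b w := fun a b w => by
    simp [hermJ]; ring
  have hsm : ∀ (r : ℝ) (a w : C3), hermJ (r • a) w = r * hermJ a w := fun r a w => by
    simp [hermJ]; ring
  simp only [hadd, hsm, hermJ_J_left, hermJ_J_right, h.self_left, h.self_right, h.cross, g1,
    g4, g5] at e1 e2 e3
  simp at e1 e2 e3
  simp [Complex.normSq_apply]
  refine ⟨?_, ?_, ?_⟩ <;> linarith

/-! ### The three types exclude each other -/

section Overlap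

variable {M : Type*} [TopologicalSpace M] [ChartedSpace E2 M]
  {f : M → CP3}

theorem IsTotallyReal.isUnitaryPair (hf : IsTotallyReal f) {q : M} {u v : TangentSpace 𝓘(ℝ, E2) q}
    (h : IsOrthonormalPair (f q) (push f q u) (push f q v)) :
    IsUnitaryPair (f q) (push f q u) (push f q v) :=
  .of_orthonormal h (hf.totallyReal q u v)

theorem push_add (q : M) (u v : TangentSpace 𝓘(ℝ, E2) q) :
    push f q (u + v) = push f q u + push f q v := map_add (mfderiv 𝓘(ℝ, E2) 𝓘(ℝ, C3) f q) u v

theorem push_smul (q : M) (a : ℝ) (u : TangentSpace 𝓘(ℝ, E2) q) :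
    push f q (a • u) = a • push f q u := map_smul (mfderiv 𝓘(ℝ, E2) 𝓘(ℝ, C3) f q) a u

theorem exists_combination {q : M} {u v : TangentSpace 𝓘(ℝ, E2) q}
    (h : IsOrthonormalPair (f q) (push f q u) (push f q v)) (w : TangentSpace 𝓘(ℝ, E2) q) :
    ∃ a b : ℝ, push f q w = a • push f q u + b • push f q v := by
  obtain ⟨h1, h2, h3⟩ := h
  have hli : LinearIndependent ℝ ![(u : E2), (v : E2)] := by
    rw [LinearIndependent.pair_iff]
    intro s t hst
    have hp : s • push f q u + t • push f q v = 0 := by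
      rw [← push_smul, ← push_smul, ← push_add]
      exact (congrArg (push f q) hst).trans (map_zero (mfderiv 𝓘(ℝ, E2) 𝓘(ℝ, C3) f q))
    have h4 : nkMetric (f q) (push f q u) (s • push f q u + t • push f q v) = 0 := by
      rw [hp, map_zero]
    have h5 : nkMetric (f q) (s • push f q u + t • push f q v) (push f q v) = 0 := by
      rw [hp, map_zero]; rfl
    rw [map_add, map_smul, map_smul, h1, h3] at h4
    simp only [map_add, map_smul, add_apply, smul_apply, h2,
      h3] at h5
    simp at h4 h5
    exact ⟨h4, h5⟩
  have hw : (w : E2) ∈ Submodule.span ℝ (Set.range ![(u : E2), (v : E2)]) := by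
    have hfin : Module.finrank ℝ E2 = 2 := by simp
    rw [hli.span_eq_top_of_card_eq_finrank (by rw [Fintype.card_fin]; exact hfin.symm)]
    trivial
  rw [Matrix.range_cons, Matrix.range_cons, Matrix.range_empty, Set.union_empty,
    Set.singleton_union, Submodule.mem_span_pair] at hw
  obtain ⟨a, b, rfl⟩ := hw
  refine ⟨a, b, ?_⟩
  rw [← push_smul, ← push_smul, ← push_add]

/-- The trace and the determinant of the form `g(J_∘ X, J Y)` on a tangent plane do not depend on the
orthonormal frame. -/
theorem trace_det_eq (hf : IsTotallyReal f) {q : M} {u v u' v' : TangentSpace 𝓘(ℝ, E2) q}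
    (h : IsOrthonormalPair (f q) (push f q u) (push f q v))
    (h' : IsOrthonormalPair (f q) (push f q u') (push f q v'))
    {b₁ b₂ b₄ b₅ c₃ c₄ c₅ b₁' b₂' b₄' b₅' c₃' c₄' c₅' : ℝ}
    (hc : HasCoefficients (f q) (push f q u) (push f q v) b₁ b₂ b₄ b₅ c₃ c₄ c₅)
    (hc' : HasCoefficients (f q) (push f q u') (push f q v') b₁' b₂' b₄' b₅' c₃' c₄' c₅') :
    b₂ + c₃ = b₂' + c₃' ∧ b₂ * c₃ = b₂' * c₃' := by
  obtain ⟨e1, e2, e3⟩ := (hf.isUnitaryPair h).eq_of_hasCoefficients hc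
  obtain ⟨e1', e2', e3'⟩ := (hf.isUnitaryPair h').eq_of_hasCoefficients hc'
  obtain ⟨p, r, hu⟩ := exists_combination h u'
  obtain ⟨s, t, hv⟩ := exists_combination h v'
  obtain ⟨h1, h2, h3⟩ := h
  obtain ⟨h1', h2', h3'⟩ := h'
  have hexp : ∀ a b c d : ℝ, nkMetric (f q) (a • push f q u + b • push f q v)
      (c • push f q u + d • push f q v) = a * c + b * d := fun a b c d => by
    have h4 : nkMetric (f q) (push f q v) (push f q u) = 0 := by
      rw [nkMetric_eq_hermJ] at h3 ⊢
      rw [hermJ_conj]; simpa using h3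
    simp only [map_add, map_smul, add_apply, smul_apply, h1,
      h2, h3, h4]
    simp; ring
  rw [hu, hexp] at h1'
  rw [hv, hexp] at h2'
  rw [hu, hv, hexp] at h3'
  rw [hu] at e1' e2'
  rw [hv] at e1' e3'
  -- The change of frame has orthonormal rows, hence orthonormal columns and determinant `±1`.
  have hM : !![p, r; s, t] * !![p, s; r, t] = (1 : Matrix (Fin 2) (Fin 2) ℝ) := by
    ext i k
    fin_cases i <;> fin_cases k <;> simp [Matrix.mul_apply] <;> linarith
  have hM' := mul_eq_one_comm.1 hM
  have m1 := congrFun (congrFun hM' 0) 0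
  have m2 := congrFun (congrFun hM' 0) 1
  have m3 := congrFun (congrFun hM' 1) 1
  simp [Matrix.mul_apply] at m1 m2 m3
  have hdet : (p * t - r * s) ^ 2 = 1 := by
    linear_combination (s * s + t * t) * h1' + h2' - (p * s + r * t) * h3'
  set a : ℂ := push f q u 0
  set b : ℂ := push f q v 0
  simp [Complex.normSq_apply] at e1 e2 e3 e1' e2' e3'
  have hsum : b₂ + c₃ = b₂' + c₃' := by
    rw [e2, e3, e2', e3']
    linear_combination 2 * (a.re ^ 2 + a.im ^ 2) * m1 + 2 * (b.re ^ 2 + b.im ^ 2) * m3 +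
      4 * (a.re * b.re + a.im * b.im) * m2
  refine ⟨hsum, ?_⟩
  have hm : (a.re * a.re + a.im * a.im) * (b.re * b.re + b.im * b.im) =
      ((p * a.re + r * b.re) * (p * a.re + r * b.re) + (p * a.im + r * b.im) * (p * a.im + r * b.im)) *
      ((s * a.re + t * b.re) * (s * a.re + t * b.re) +
        (s * a.im + t * b.im) * (s * a.im + t * b.im)) := by
    -- As `Re (ā b) = 0`, the product `|a|² |b|²` is the square of the area spanned by `a, b` in
    -- `ℝ²`, which a change of frame multiplies by the squared determinant 1.
    have l1 : (a.re * a.re + a.im * a.im) * (b.re * b.re + b.im * b.im) =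
        (a.re * b.im - a.im * b.re) ^ 2 := by
      linear_combination (a.re * b.re + a.im * b.im) * e1
    have l2 : ((p * a.re + r * b.re) * (p * a.re + r * b.re) +
        (p * a.im + r * b.im) * (p * a.im + r * b.im)) *
        ((s * a.re + t * b.re) * (s * a.re + t * b.re) +
        (s * a.im + t * b.im) * (s * a.im + t * b.im)) =
        ((p * a.re + r * b.re) * (s * a.im + t * b.im) -
          (p * a.im + r * b.im) * (s * a.re + t * b.re)) ^ 2 := by
      linear_combination ((p * a.re + r * b.re) * (s * a.re + t * b.re) +
        (p * a.im + r * b.im) * (s * a.im + t * b.im)) * e1'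
    rw [l1, l2]
    linear_combination -(a.re * b.im - a.im * b.re) ^ 2 * hdet
  have h5 : (1 - b₂) * (1 - c₃) = (1 - b₂') * (1 - c₃') := by
    rw [e2, e3, e2', e3']
    linear_combination 4 * hm
  linear_combination h5 + hsum

/-- The trace `b₂ + c₃` is `1 + sin α > 0` for Type 0, `1` for Type 1 and `0` for Type 2. Equality
of Types 0 and 1 forces `α = 0`, and then the determinant `1/4` forces `λ² = 1`, the excluded case.
-/
theorem types_disjoint (hf : IsTotallyReal f) (q : M) :
    ¬ (IsType0At f q ∧ IsType1At f q) ∧ ¬ (IsType0At f q ∧ IsType2At f q) ∧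
      ¬ (IsType1At f q ∧ IsType2At f q) := by
  have hs : ∀ l s : ℝ, (l ^ 2 + s) / (1 + l ^ 2) + (1 + l ^ 2 * s) / (1 + l ^ 2) = 1 + s :=
    fun l s => by
      have : 1 + l ^ 2 ≠ 0 := by positivity
      field_simp; ring
  refine ⟨?_, ?_, ?_⟩
  · rintro ⟨⟨u, v, h, l, α, θ, hα, hne, hc⟩, ⟨u', v', h', hc'⟩⟩
    obtain ⟨e1, e2⟩ := trace_det_eq hf h h' hc hc'
    rw [hs] at e1
    have hsin : Real.sin α = 0 := by linarith
    have hα0 : α = 0 := by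
      rcases lt_trichotomy α 0 with h0 | h0 | h0
      · have := Real.sin_neg_of_neg_of_neg_pi_lt h0 (by linarith [hα.1, Real.pi_pos]); linarith
      · exact h0
      · have := Real.sin_pos_of_pos_of_lt_pi h0 (by linarith [hα.2, Real.pi_pos]); linarith
    refine hne ⟨?_, hα0⟩
    rw [hsin] at e2
    have : 1 + l ^ 2 ≠ 0 := by positivity
    field_simp at e2
    nlinarith [sq_nonneg (l ^ 2 - 1)]
  · rintro ⟨⟨u, v, h, l, α, θ, hα, -, hc⟩, ⟨u', v', h', β, hc'⟩⟩
    obtain ⟨e1, -⟩ := trace_det_eq hf h h' hc hc'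
    rw [hs] at e1
    have hsin : Real.sin (-(Real.pi / 2)) < Real.sin α :=
      Real.sin_lt_sin_of_lt_of_le_pi_div_two le_rfl hα.2.le hα.1
    rw [Real.sin_neg, Real.sin_pi_div_two] at hsin
    linarith
  · rintro ⟨⟨u, v, h, hc⟩, ⟨u', v', h', β, hc'⟩⟩
    obtain ⟨e1, -⟩ := trace_det_eq hf h h' hc hc'
    linarith

end Overlap

/-! ### Smooth adapted frames along a surface -/

section Frames

variable {M : Type*} [TopologicalSpace M] [ChartedSpace E2 M]
  {f : M → CP3}

/-- The part of the surface that the preferred chart at `x` covers. -/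
def chartDomain (f : M → CP3) (x : CP3) : Set M := f ⁻¹' (chartAt C3 x).source

/-- The surface read in the preferred chart at `x`. -/
def inChart (f : M → CP3) (x : CP3) (q : M) : C3 := chartAt C3 x (f q)

/-- The differential of the surface read in the preferred chart at `x`. -/
def dInChart (f : M → CP3) (x : CP3) (q : M) (w : TangentSpace 𝓘(ℝ, E2) q) : C3 :=
  mfderiv 𝓘(ℝ, E2) 𝓘(ℝ, C3) (inChart f x) q w

theorem isOpen_chartDomain (hf : IsTotallyReal f) (x : CP3) : IsOpen (chartDomain f x) :=
  (chartAt C3 x).open_source.preimage hf.smooth.continuous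

theorem contMDiffOn_inChart (hf : IsTotallyReal f) (x : CP3) :
    ContMDiffOn 𝓘(ℝ, E2) 𝓘(ℝ, C3) ∞ (inChart f x) (chartDomain f x) :=
  (contMDiffOn_chart (I := 𝓘(ℝ, C3)) (x := x)).comp hf.smooth.contMDiffOn (fun _ h => h)

theorem push_eq_dParam (hf : IsTotallyReal f) {x : CP3} {q : M} (hq : q ∈ chartDomain f x)
    (w : TangentSpace 𝓘(ℝ, E2) q) :
    (push f q w : C3) = dParam x (inChart f x q) (dInChart f x q w) := by
  obtain ⟨C, c, -, -, -, -, -, hd⟩ := exists_transition x (inChart f x q)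
  have hY : MDifferentiableAt 𝓘(ℝ, E2) 𝓘(ℝ, C3) (inChart f x) q :=
    ((contMDiffOn_inChart hf x).contMDiffAt
      ((isOpen_chartDomain hf x).mem_nhds hq)).mdifferentiableAt (by simp)
  have hcomp := HasMFDerivAt.comp q hd hY.hasMFDerivAt
  have heq : f =ᶠ[𝓝 q] (chartAt C3 x).symm ∘ inChart f x := by
    filter_upwards [(isOpen_chartDomain hf x).mem_nhds hq] with q' hq'
    exact ((chartAt C3 x).left_inv hq').symm
  have h := hcomp.congr_of_eventuallyEq heq
  rw [push, h.mfderiv]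
  rfl

variable [IsManifold 𝓘(ℝ, E2) ∞ M]

theorem SmoothFieldOn.dInChart (hf : IsTotallyReal f) {x : CP3} {N : Set M}
    {u : ∀ q : M, TangentSpace 𝓘(ℝ, E2) q} (hN : N ⊆ chartDomain f x) (hu : SmoothFieldOn N u) :
    ContMDiffOn 𝓘(ℝ, E2) 𝓘(ℝ, C3) ∞ (fun q => dInChart f x q (u q)) N := by
  have hS := isOpen_chartDomain hf x
  have h1 := (contMDiffOn_inChart hf x).contMDiffOn_tangentMapWithin (m := ∞) (by simp)
    hS.uniqueMDiffOn
  have h2 := h1.comp hu (fun q hq => hN hq)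
  have h3 := (contMDiff_snd_tangentBundle_modelSpace (n := ∞) C3 𝓘(ℝ, C3)).comp_contMDiffOn h2
  refine h3.congr fun q hq => ?_
  change _ = mfderivWithin 𝓘(ℝ, E2) 𝓘(ℝ, C3) (inChart f x) (chartDomain f x) q (u q)
  rw [mfderivWithin_of_isOpen hS (hN hq)]
  rfl

theorem SmoothFieldOn.add {N : Set M} {u v : ∀ q : M, TangentSpace 𝓘(ℝ, E2) q}
    (hu : SmoothFieldOn N u) (hv : SmoothFieldOn N v) : SmoothFieldOn N (fun q => u q + v q) :=
  ContMDiffOn.add_section hu hv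

theorem SmoothFieldOn.smul {N : Set M} {a : M → ℝ} {u : ∀ q : M, TangentSpace 𝓘(ℝ, E2) q}
    (ha : SmoothFunOn N a) (hu : SmoothFieldOn N u) : SmoothFieldOn N (fun q => a q • u q) :=
  ContMDiffOn.smul_section ha hu

/-- A local trivialisation of the tangent bundle carries a basis of `ℝ²` to a smooth local frame. -/
theorem exists_local_fields (q₀ : M) : ∃ (N : Set M) (u v : ∀ q : M, TangentSpace 𝓘(ℝ, E2) q),
    IsOpen N ∧ q₀ ∈ N ∧ SmoothFieldOn N u ∧ SmoothFieldOn N v ∧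
      ∀ q ∈ N, LinearIndependent ℝ ![u q, v q] := by
  set e := trivializationAt E2 (TangentSpace 𝓘(ℝ, E2) : M → Type _) q₀
  set b : Module.Basis (Fin 2) ℝ E2 := (EuclideanSpace.basisFun (Fin 2) ℝ).toBasis
  have h := e.isLocalFrameOn_localFrame_baseSet 𝓘(ℝ, E2) ∞ b
  refine ⟨e.baseSet, e.localFrame b 0, e.localFrame b 1, e.open_baseSet,
    FiberBundle.mem_baseSet_trivializationAt' q₀, h.contMDiffOn 0, h.contMDiffOn 1, fun q hq => ?_⟩
  have := h.linearIndependent hq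
  have heq : ![e.localFrame b 0 q, e.localFrame b 1 q] = fun i => e.localFrame b i q := by
    funext i; fin_cases i <;> rfl
  rw [heq]
  exact this

end Frames

/-! ### Smooth orthonormal frames and the first components of their vectors. -/

section FrameData

variable {M : Type*} [TopologicalSpace M] [ChartedSpace E2 M]

/-- The function `a` with values in a normed space is smooth on `N`. -/
def SmoothMapOn {F : Type*} [NormedAddCommGroup F] [NormedSpace ℝ F] (N : Set M) (a : M → F) : Prop :=
  ContMDiffOn 𝓘(ℝ, E2) 𝓘(ℝ, F) ∞ a N

section SmoothMapOn

variable {F F' : Type*} [NormedAddCommGroup F] [NormedSpace ℝ F] [NormedAddCommGroup F']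
  [NormedSpace ℝ F'] {N : Set M}

theorem SmoothMapOn.comp {a : M → F} {g : F → F'} (ha : SmoothMapOn N a)
    (hg : ∀ q ∈ N, ContDiffAt ℝ ∞ g (a q)) : SmoothMapOn N (fun q => g (a q)) :=
  fun q hq => (hg q hq).comp_contMDiffWithinAt (ha q hq)

theorem SmoothMapOn.comp' {a : M → F} {g : F → F'} (ha : SmoothMapOn N a)
    (hg : ContDiff ℝ ∞ g) : SmoothMapOn N (fun q => g (a q)) :=
  ha.comp fun _ _ => hg.contDiffAt

theorem SmoothMapOn.prod {a : M → F} {b : M → F'} (ha : SmoothMapOn N a) (hb : SmoothMapOn N b) :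
    SmoothMapOn N (fun q => (a q, b q)) := ContMDiffOn.prodMk_space ha hb

theorem SmoothMapOn.const (c : F) : SmoothMapOn N (fun _ => c) := contMDiffOn_const

theorem SmoothMapOn.add {a b : M → F} (ha : SmoothMapOn N a) (hb : SmoothMapOn N b) :
    SmoothMapOn N (fun q => a q + b q) := ContMDiffOn.add ha hb

theorem SmoothMapOn.sub {a b : M → F} (ha : SmoothMapOn N a) (hb : SmoothMapOn N b) :
    SmoothMapOn N (fun q => a q - b q) := ContMDiffOn.sub ha hb

theorem SmoothMapOn.neg {a : M → F} (ha : SmoothMapOn N a) :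
    SmoothMapOn N (fun q => -a q) := ContMDiffOn.neg ha

theorem SmoothMapOn.mul {A : Type*} [NormedRing A] [NormedAlgebra ℝ A] {a b : M → A}
    (ha : SmoothMapOn N a) (hb : SmoothMapOn N b) : SmoothMapOn N (fun q => a q * b q) :=
  (ha.prod hb).comp' contDiff_mul

theorem SmoothMapOn.inv {K : Type*} [NormedField K] [CompleteSpace K] [NormedAlgebra ℝ K] {a : M → K}
    (ha : SmoothMapOn N a) (h0 : ∀ q ∈ N, a q ≠ 0) : SmoothMapOn N (fun q => (a q)⁻¹) :=
  ha.comp fun q hq => contDiffAt_inv ℝ (h0 q hq)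

theorem SmoothMapOn.div {K : Type*} [NormedField K] [CompleteSpace K] [NormedAlgebra ℝ K]
    {a b : M → K} (ha : SmoothMapOn N a) (hb : SmoothMapOn N b) (h0 : ∀ q ∈ N, b q ≠ 0) :
    SmoothMapOn N (fun q => a q / b q) := by
  simp only [div_eq_mul_inv]
  exact ha.mul (hb.inv h0)

theorem SmoothMapOn.sqrt {a : M → ℝ} (ha : SmoothMapOn N a) (h0 : ∀ q ∈ N, a q ≠ 0) :
    SmoothMapOn N (fun q => √(a q)) :=
  ha.comp fun q hq => Real.contDiffAt_sqrt (h0 q hq)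

theorem SmoothMapOn.ofReal {a : M → ℝ} (ha : SmoothMapOn N a) : SmoothMapOn N (fun q => (a q : ℂ)) :=
  ha.comp' Complex.ofRealCLM.contDiff

theorem SmoothMapOn.re {a : M → ℂ} (ha : SmoothMapOn N a) : SmoothMapOn N (fun q => (a q).re) :=
  ha.comp' Complex.reCLM.contDiff

theorem SmoothMapOn.im {a : M → ℂ} (ha : SmoothMapOn N a) : SmoothMapOn N (fun q => (a q).im) :=
  ha.comp' Complex.imCLM.contDiff

theorem SmoothMapOn.conj {a : M → ℂ} (ha : SmoothMapOn N a) : SmoothMapOn N (fun q => star (a q)) :=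
  ha.comp' Complex.conjCLE.contDiff

theorem SmoothMapOn.norm {a : M → ℂ} (ha : SmoothMapOn N a) (h0 : ∀ q ∈ N, a q ≠ 0) :
    SmoothMapOn N (fun q => ‖a q‖) :=
  ha.comp fun q hq => contDiffAt_norm ℝ (h0 q hq)

theorem SmoothMapOn.mono {a : M → F} {N' : Set M} (ha : SmoothMapOn N a) (h : N' ⊆ N) :
    SmoothMapOn N' a := ContMDiffOn.mono ha h

theorem SmoothMapOn.isOpen_preimage {a : M → F} (ha : SmoothMapOn N a) (hN : IsOpen N) {s : Set F}
    (hs : IsOpen s) : IsOpen {q | q ∈ N ∧ a q ∈ s} :=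
  (ContMDiffOn.continuousOn ha).isOpen_inter_preimage hN hs

end SmoothMapOn

/-- A smooth orthonormal frame `u`, `v` on the open set `N`, and smooth functions `a`, `b`, `c` that
are the first components of `u`, `v`, `G(u, v)` up to a common phase at every point. -/
structure IsFrameData [IsManifold 𝓘(ℝ, E2) ∞ M] (f : M → CP3) (N : Set M) (u v : ∀ q : M, TangentSpace 𝓘(ℝ, E2) q)
    (a b c : M → ℂ) : Prop where
  isOpen : IsOpen N
  smooth_u : SmoothFieldOn N u
  smooth_v : SmoothFieldOn N v
  smooth_a : SmoothMapOn N a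
  smooth_b : SmoothMapOn N b
  smooth_c : SmoothMapOn N c
  orthonormal : ∀ q ∈ N, IsOrthonormalPair (f q) (push f q (u q)) (push f q (v q))
  phase : ∀ q ∈ N, ∃ e : ℂ, e * star e = 1 ∧ push f q (u q) 0 = e * a q ∧
    push f q (v q) 0 = e * b q ∧ G (f q) (push f q (u q)) (push f q (v q)) 0 = e * c q

/-- The metric `g` at the point with coordinate `y` of a preferred chart. -/
def chartMetric (y v w : C3) : ℝ := 2 * (herm v w).re / normSqEmb y -
  (2 * (star (radial y v) * radial y w).re + (star (contact y v) * contact y w).re) / normSqEmb y ^ 2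

/-- The first component of `G` in the preferred chart, up to a phase. -/
def chartG (y v w : C3) : ℂ := -(2 * Complex.I) *
  (area v w - (radial y v * contact y w - contact y v * radial y w) / normSqEmb y)

variable {f : M → CP3}

theorem SmoothMapOn.chartMetric {N : Set M} {y v w : M → C3} (hy : SmoothMapOn N y)
    (hv : SmoothMapOn N v) (hw : SmoothMapOn N w) :
    SmoothMapOn N (fun q => chartMetric (y q) (v q) (w q)) := by
  refine (hy.prod (hv.prod hw)).comp' (g := fun p : C3 × C3 × C3 => CP3.chartMetric p.1 p.2.1 p.2.2) ?_
  have h1 : ContDiff ℝ ∞ fun p : C3 × C3 × C3 => p.1 := contDiff_fst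
  have h2 : ContDiff ℝ ∞ fun p : C3 × C3 × C3 => p.2.1 := contDiff_snd.fst
  have h3 : ContDiff ℝ ∞ fun p : C3 × C3 × C3 => p.2.2 := contDiff_snd.snd
  have hN := contDiff_normSqEmb h1
  refine ((contDiff_const.mul (contDiff_re (contDiff_herm h2 h3))).div hN
    fun y => (normSqEmb_pos _).ne').sub
    (ContDiff.div ?_ (hN.pow 2) fun y => (pow_pos (normSqEmb_pos _) 2).ne')
  exact (contDiff_const.mul (contDiff_re ((contDiff_star (contDiff_radial h1 h2)).mul
    (contDiff_radial h1 h3)))).add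
    (contDiff_re ((contDiff_star (contDiff_contact h1 h2)).mul (contDiff_contact h1 h3)))

theorem SmoothMapOn.contact_div {N : Set M} {y v : M → C3} (hy : SmoothMapOn N y)
    (hv : SmoothMapOn N v) : SmoothMapOn N (fun q => contact (y q) (v q) / (normSqEmb (y q) : ℂ)) := by
  refine (hy.prod hv).comp' (g := fun p : C3 × C3 => contact p.1 p.2 / (normSqEmb p.1 : ℂ)) ?_
  have h1 : ContDiff ℝ ∞ fun p : C3 × C3 => p.1 := contDiff_fst
  simp only [div_eq_mul_inv]
  refine (contDiff_contact h1 contDiff_snd).mul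
    (ContDiff.inv (contDiff_ofReal (contDiff_normSqEmb h1)) fun y => ?_)
  exact_mod_cast (normSqEmb_pos _).ne'

theorem SmoothMapOn.chartG_div {N : Set M} {y v w : M → C3} (hy : SmoothMapOn N y)
    (hv : SmoothMapOn N v) (hw : SmoothMapOn N w) :
    SmoothMapOn N (fun q => chartG (y q) (v q) (w q) / (normSqEmb (y q) : ℂ)) := by
  refine (hy.prod (hv.prod hw)).comp'
    (g := fun p : C3 × C3 × C3 => chartG p.1 p.2.1 p.2.2 / (normSqEmb p.1 : ℂ)) ?_
  have h1 : ContDiff ℝ ∞ fun p : C3 × C3 × C3 => p.1 := contDiff_fst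
  have h2 : ContDiff ℝ ∞ fun p : C3 × C3 × C3 => p.2.1 := contDiff_snd.fst
  have h3 : ContDiff ℝ ∞ fun p : C3 × C3 × C3 => p.2.2 := contDiff_snd.snd
  have hinv : ContDiff ℝ ∞ fun p : C3 × C3 × C3 => ((normSqEmb p.1 : ℝ) : ℂ)⁻¹ :=
    ContDiff.inv (contDiff_ofReal (contDiff_normSqEmb h1)) fun y => by
      exact_mod_cast (normSqEmb_pos _).ne'
  simp only [chartG, div_eq_mul_inv]
  exact (contDiff_const.mul ((contDiff_area h2 h3).sub ((((contDiff_radial h1 h2).mul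
    (contDiff_contact h1 h3)).sub ((contDiff_contact h1 h2).mul (contDiff_radial h1 h3))).mul
      hinv))).mul hinv

theorem nkMetric_push (hf : IsTotallyReal f) {x : CP3} {q : M} (hq : q ∈ chartDomain f x)
    (v w : TangentSpace 𝓘(ℝ, E2) q) : nkMetric (f q) (push f q v) (push f q w) =
      chartMetric (inChart f x q) (dInChart f x q v) (dInChart f x q w) := by
  rw [chartMetric, ← metricInChart_apply x, nkMetric_eq_herm, push_eq_dParam hf hq,
    push_eq_dParam hf hq]
  exact (nkMetric_eq_herm _ _ _).symm

/-- The preferred charts at the points `f q` are chosen without continuity, so first components in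
them need not be smooth. Expressions in the fixed chart at `x` differ from them only by a common
phase, which does not affect the coefficients of `J_∘`. -/
theorem phase_push (hf : IsTotallyReal f) {x : CP3} {q : M} (hq : q ∈ chartDomain f x)
    (v w : TangentSpace 𝓘(ℝ, E2) q) : ∃ e : ℂ, e * star e = 1 ∧
      push f q v 0 = e * (contact (inChart f x q) (dInChart f x q v) / normSqEmb (inChart f x q)) ∧
      push f q w 0 = e * (contact (inChart f x q) (dInChart f x q w) / normSqEmb (inChart f x q)) ∧
      G (f q) (push f q v) (push f q w) 0 = e *
        (chartG (inChart f x q) (dInChart f x q v) (dInChart f x q w) /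
          normSqEmb (inChart f x q)) := by
  obtain ⟨c, hc, hcn, h0, ha, -⟩ := exists_dParam_apply x (inChart f x q)
  have hsc : star c ≠ 0 := by simpa using hc
  -- All three components carry the factor `1 / c²`; replacing it by `1 / |c|²` leaves the phase `c̄
  -- / c`.
  refine ⟨c * star c / c ^ 2, ?_, ?_, ?_, ?_⟩
  · rw [star_div₀, star_mul, star_pow, star_star]
    field_simp
  · rw [push_eq_dParam hf hq, h0, ← hcn]; field_simp
  · rw [push_eq_dParam hf hq, h0, ← hcn]; field_simp
  · have h1 : G (f q) (push f q v) (push f q w) 0 =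
        -(2 * Complex.I) * area (push f q v) (push f q w) := by
      rw [G_apply]; simp; ring
    rw [h1, push_eq_dParam hf hq, push_eq_dParam hf hq, ha, chartG, hcn]
    have hn : (normSqEmb (inChart f x q) : ℂ) ≠ 0 := by exact_mod_cast (normSqEmb_pos _).ne'
    field_simp

theorem nkMetric_pos (x : CP3) {w : T x} (hw : w ≠ 0) : 0 < nkMetric x w w := by
  have h : nkMetric x w w = Complex.normSq (w 0) + 2 * (Complex.normSq (w 1) + Complex.normSq (w 2)) := by
    rw [nkMetric_apply]; simp [Complex.normSq_apply]
  have hn := fun i => Complex.normSq_nonneg (w i)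
  rw [h]
  by_contra hcon
  have h0 : w 0 = 0 := Complex.normSq_eq_zero.1 (by linarith [hn 0, hn 1, hn 2])
  have h1 : w 1 = 0 := Complex.normSq_eq_zero.1 (by linarith [hn 0, hn 1, hn 2])
  have h2 : w 2 = 0 := Complex.normSq_eq_zero.1 (by linarith [hn 0, hn 1, hn 2])
  refine hw ?_
  ext i
  fin_cases i
  exacts [h0, h1, h2]

variable [IsManifold 𝓘(ℝ, E2) ∞ M]

/-- Gram–Schmidt applied to a local frame, with the metric read in the fixed chart at `f q₀` so that
its coefficients are smooth. -/
theorem exists_isFrameData (hf : IsTotallyReal f) (q₀ : M) :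
    ∃ N u v a b c, q₀ ∈ N ∧ IsFrameData f N u v a b c := by
  obtain ⟨N₀, e₁, e₂, hN₀, hq₀, he₁, he₂, hli⟩ := exists_local_fields q₀
  set x := f q₀ with hx
  set N := N₀ ∩ chartDomain f x with hN
  have hNc : N ⊆ chartDomain f x := Set.inter_subset_right
  have he₁' : SmoothFieldOn N e₁ := ContMDiffOn.mono he₁ Set.inter_subset_left
  have he₂' : SmoothFieldOn N e₂ := ContMDiffOn.mono he₂ Set.inter_subset_left
  set y := inChart f x
  have hy : SmoothMapOn N y := (contMDiffOn_inChart hf x).mono hNc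
  have hd₁ : SmoothMapOn N (fun q => dInChart f x q (e₁ q)) := he₁'.dInChart hf hNc
  have hd₂ : SmoothMapOn N (fun q => dInChart f x q (e₂ q)) := he₂'.dInChart hf hNc
  set g₁₁ : M → ℝ := fun q => nkMetric (f q) (push f q (e₁ q)) (push f q (e₁ q)) with hg₁₁
  set g₁₂ : M → ℝ := fun q => nkMetric (f q) (push f q (e₁ q)) (push f q (e₂ q)) with hg₁₂
  set g₂₂ : M → ℝ := fun q => nkMetric (f q) (push f q (e₂ q)) (push f q (e₂ q)) with hg₂₂
  have s₁₁ : SmoothMapOn N g₁₁ := ContMDiffOn.congr (SmoothMapOn.chartMetric hy hd₁ hd₁)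
    fun q hq => nkMetric_push hf (hNc hq) _ _
  have s₁₂ : SmoothMapOn N g₁₂ := ContMDiffOn.congr (SmoothMapOn.chartMetric hy hd₁ hd₂)
    fun q hq => nkMetric_push hf (hNc hq) _ _
  have s₂₂ : SmoothMapOn N g₂₂ := ContMDiffOn.congr (SmoothMapOn.chartMetric hy hd₂ hd₂)
    fun q hq => nkMetric_push hf (hNc hq) _ _
  have hexp : ∀ q, ∀ a b c d : ℝ, nkMetric (f q) (push f q (a • e₁ q + b • e₂ q))
      (push f q (c • e₁ q + d • e₂ q)) =
      a * c * g₁₁ q + (a * d + b * c) * g₁₂ q + b * d * g₂₂ q := fun q a b c d => by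
    have h4 : nkMetric (f q) (push f q (e₂ q)) (push f q (e₁ q)) = g₁₂ q := by
      simp only [hg₁₂]
      rw [nkMetric_eq_hermJ, nkMetric_eq_hermJ, hermJ_conj]; simp
    simp only [push_add, push_smul, map_add, map_smul, add_apply, smul_apply, h4]
    simp; ring
  have hinj : ∀ q (w : TangentSpace 𝓘(ℝ, E2) q), w ≠ 0 → push f q w ≠ 0 := fun q w hw h0 =>
    hw (hf.immersion q (h0.trans (map_zero (mfderiv 𝓘(ℝ, E2) 𝓘(ℝ, C3) f q)).symm))
  have hpos : ∀ q ∈ N, 0 < g₁₁ q ∧ 0 < g₁₁ q * (g₁₁ q * g₂₂ q - g₁₂ q ^ 2) := fun q hq => by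
    have hl := LinearIndependent.pair_iff.1 (hli q hq.1)
    have h1 : 0 < g₁₁ q := by
      refine nkMetric_pos _ (hinj q _ fun h => ?_)
      exact one_ne_zero (hl 1 0 (by rw [h]; simp)).1
    refine ⟨h1, ?_⟩
    have h2 : 0 < nkMetric (f q) (push f q ((-g₁₂ q) • e₁ q + g₁₁ q • e₂ q))
        (push f q ((-g₁₂ q) • e₁ q + g₁₁ q • e₂ q)) :=
      nkMetric_pos _ (hinj q _ fun h => h1.ne' (hl _ _ h).2)
    rw [hexp] at h2
    linarith [h2]
  set k : M → ℝ := fun q => (√(g₁₁ q))⁻¹ with hk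
  -- `m` is the inverse length of `-g₁₂ e₁ + g₁₁ e₂`, a vector orthogonal to `e₁`.
  set m : M → ℝ := fun q => (√(g₁₁ q * (g₁₁ q * g₂₂ q - g₁₂ q ^ 2)))⁻¹ with hm
  have sk : SmoothMapOn N k := (s₁₁.sqrt fun q hq => (hpos q hq).1.ne').inv fun q hq =>
    (Real.sqrt_pos.2 (hpos q hq).1).ne'
  have sm : SmoothMapOn N m := by
    refine SmoothMapOn.inv (SmoothMapOn.sqrt ?_ fun q hq => (hpos q hq).2.ne') fun q hq =>
      (Real.sqrt_pos.2 (hpos q hq).2).ne'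
    simp only [sq]
    exact s₁₁.mul ((s₁₁.mul s₂₂).sub (s₁₂.mul s₁₂))
  have hkk : ∀ q ∈ N, k q * k q * g₁₁ q = 1 := fun q hq => by
    have h := (hpos q hq).1
    simp only [hk]
    rw [← mul_inv, Real.mul_self_sqrt h.le, inv_mul_cancel₀ h.ne']
  have hmm : ∀ q ∈ N, m q * m q * (g₁₁ q * (g₁₁ q * g₂₂ q - g₁₂ q ^ 2)) = 1 := fun q hq => by
    have h := (hpos q hq).2
    simp only [hm]
    rw [← mul_inv, Real.mul_self_sqrt h.le, inv_mul_cancel₀ h.ne']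
  -- The zero multiple of `e₂` puts `u` in the shape to which `hexp` applies.
  set u : ∀ q : M, TangentSpace 𝓘(ℝ, E2) q := fun q => k q • e₁ q + (0 : ℝ) • e₂ q with hu
  set v : ∀ q : M, TangentSpace 𝓘(ℝ, E2) q :=
    fun q => (-(m q * g₁₂ q)) • e₁ q + (m q * g₁₁ q) • e₂ q with hv
  have su : SmoothFieldOn N u := SmoothFieldOn.add (.smul sk he₁') (.smul (SmoothMapOn.const 0) he₂')
  have sv : SmoothFieldOn N v :=
    SmoothFieldOn.add (.smul (sm.mul s₁₂).neg he₁') (.smul (sm.mul s₁₁) he₂')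
  have hdu : SmoothMapOn N (fun q => dInChart f x q (u q)) := su.dInChart hf hNc
  have hdv : SmoothMapOn N (fun q => dInChart f x q (v q)) := sv.dInChart hf hNc
  refine ⟨N, u, v, _, _, _, ⟨hq₀, mem_chart_source C3 x⟩, hN₀.inter (isOpen_chartDomain hf x), su, sv,
    hy.contact_div hdu, hy.contact_div hdv, hy.chartG_div hdu hdv, fun q hq => ?_,
    fun q hq => phase_push hf (hNc hq) _ _⟩
  have h1 := hkk q hq
  have h2 := hmm q hq
  refine ⟨?_, ?_, ?_⟩
  · rw [hu, hexp]; linarith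
  · rw [hv, hexp]; linarith
  · rw [hu, hv, hexp]; ring

end FrameData

/-! ### No open piece of the surface is tangent to `𝒟₂⁴`. -/

section Legendrian

/-- If the contact form vanishes on a smooth map, then so does its differential. -/
theorem area_fderiv_eq_zero {h : E2 → C3} {z : E2} (hd : ContDiffAt ℝ ∞ h z)
    (hc : ∀ᶠ z' in 𝓝 z, ∀ e, contact (h z') (fderiv ℝ h z' e) = 0) (e e' : E2) :
    area (fderiv ℝ h z e) (fderiv ℝ h z e') = 0 := by
  have h2 : (2 : WithTop ℕ∞) ≤ ∞ := WithTop.coe_le_coe.2 (le_top : (2 : ℕ∞) ≤ ⊤)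
  set D := fderiv ℝ h with hD
  set S := fderiv ℝ D z with hS
  have hD' : HasFDerivAt D S z :=
    ((hd.fderiv_right (m := ∞) (by simp)).differentiableAt (by simp)).hasFDerivAt
  have hh : HasFDerivAt h (D z) z := (hd.differentiableAt (by simp)).hasFDerivAt
  have hsymm : S e e' = S e' e := (hd.isSymmSndFDerivAt (by simpa using h2)) e e'
  have hproj : ∀ (i : Fin 3), HasFDerivAt (fun z => h z i)
      (((EuclideanSpace.proj i : C3 →L[ℂ] ℂ).restrictScalars ℝ) ∘L D z) z := fun i =>
    ((EuclideanSpace.proj i : C3 →L[ℂ] ℂ).restrictScalars ℝ).hasFDerivAt.comp z hh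
  have hDe : ∀ (a : E2) (i : Fin 3), HasFDerivAt (fun z => D z a i)
      (((EuclideanSpace.proj i : C3 →L[ℂ] ℂ).restrictScalars ℝ) ∘L (S.flip a)) z := fun a i => by
    have h1 : HasFDerivAt (fun z => D z a) (S.flip a) z := by
      simpa using hD'.clm_apply (hasFDerivAt_const a z)
    exact ((EuclideanSpace.proj i : C3 →L[ℂ] ℂ).restrictScalars ℝ).hasFDerivAt.comp z h1
  -- Differentiate the contact condition for `a` in the direction `b`. Antisymmetrising removes the
  -- symmetric second derivative and leaves the exterior derivative, which is twice `area`.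
  have key : ∀ a b : E2, contact (h z) (S b a) - D z b 2 * D z a 1 + D z b 1 * D z a 2 = 0 :=
    fun a b => by
      have h0 : (fun z => contact (h z) (D z a)) =ᶠ[𝓝 z] fun _ => 0 := hc.mono fun z' hz' => hz' a
      have h1 := (((hDe a 0).sub ((hproj 2).mul (hDe a 1))).add ((hproj 1).mul (hDe a 2)))
      have h2 := h1.unique ((hasFDerivAt_const (0 : ℂ) z).congr_of_eventuallyEq h0)
      have h3 := congrArg (fun L : E2 →L[ℝ] ℂ => L b) h2
      simp at h3
      simp only [contact]
      linear_combination h3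
  have k1 := key e e'
  have k2 := key e' e
  rw [hsymm] at k2
  simp only [area]
  linear_combination (k2 - k1) / 2

variable {M : Type*} [TopologicalSpace M] [ChartedSpace E2 M] [IsManifold 𝓘(ℝ, E2) ∞ M]
  {f : M → CP3}

/-- If `a` and `b` vanished identically, the tangent planes would lie in the contact distribution.
Then `area`, and with it the first component of `G(u, v)`, would vanish too, against the unit
column. -/
theorem IsFrameData.exists_ne_zero (hf : IsTotallyReal f) {N : Set M}
    {u v : ∀ q : M, TangentSpace 𝓘(ℝ, E2) q} {a b c : M → ℂ} (h : IsFrameData f N u v a b c)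
    (hN : N.Nonempty) : ∃ q ∈ N, a q ≠ 0 ∨ b q ≠ 0 := by
  by_contra! hcon
  have hu0 : ∀ q ∈ N, push f q (u q) 0 = 0 := fun q hq => by
    obtain ⟨e, -, h1, -⟩ := h.phase q hq
    rw [h1, (hcon q hq).1, mul_zero]
  have hv0 : ∀ q ∈ N, push f q (v q) 0 = 0 := fun q hq => by
    obtain ⟨e, -, -, h1, -⟩ := h.phase q hq
    rw [h1, (hcon q hq).2, mul_zero]
  have hw0 : ∀ q ∈ N, ∀ w, push f q w 0 = 0 := fun q hq w => by
    obtain ⟨s, t, hst⟩ := exists_combination (h.orthonormal q hq) w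
    rw [hst]
    simp [hu0 q hq, hv0 q hq]
  obtain ⟨q₀, hq₀⟩ := hN
  set x := f q₀
  have hcon' : ∀ q ∈ N ∩ chartDomain f x, ∀ w, contact (inChart f x q) (dInChart f x q w) = 0 := by
    intro q hq w
    obtain ⟨c, hc, -, h0, -⟩ := exists_dParam_apply x (inChart f x q)
    have h1 := hw0 q hq.1 w
    rw [push_eq_dParam hf hq.2, h0] at h1
    exact (div_eq_zero_iff.1 h1).resolve_right (pow_ne_zero 2 hc)
  have hx₀ : q₀ ∈ chartDomain f x := mem_chart_source C3 x
  have hS : IsOpen (N ∩ chartDomain f x) := h.isOpen.inter (isOpen_chartDomain hf x)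
  set φ := chartAt E2 q₀ with hφ
  set H : E2 → C3 := inChart f x ∘ φ.symm with hH
  -- The open part of the coordinate plane of `M` on which the surface is a map `H` into the chart
  -- `ℂ³` and the contact condition holds.
  set Z : Set E2 := φ.target ∩ φ.symm ⁻¹' (N ∩ chartDomain f x) with hZ
  have hZo : IsOpen Z := φ.symm.isOpen_inter_preimage hS
  have hφ₀ : φ.symm (φ q₀) = q₀ := φ.left_inv (mem_chart_source E2 q₀)
  have hz₀ : φ q₀ ∈ Z := by
    refine ⟨φ.map_source (mem_chart_source E2 q₀), ?_⟩
    rw [Set.mem_preimage, hφ₀]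
    exact ⟨hq₀, hx₀⟩
  have hHs : ContDiffOn ℝ ∞ H Z := by
    rw [← contMDiffOn_iff_contDiffOn]
    exact (contMDiffOn_inChart hf x).comp
      ((contMDiffOn_chart_symm (I := 𝓘(ℝ, E2)) (x := q₀)).mono Set.inter_subset_left)
      fun z hz => hz.2.2
  have hfd : ∀ z ∈ Z, ∀ e, fderiv ℝ H z e = dInChart f x (φ.symm z)
      (mfderiv 𝓘(ℝ, E2) 𝓘(ℝ, E2) φ.symm z e) := fun z hz e => by
    have h1 : MDifferentiableAt 𝓘(ℝ, E2) 𝓘(ℝ, C3) (inChart f x) (φ.symm z) :=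
      ((contMDiffOn_inChart hf x).contMDiffAt
        ((isOpen_chartDomain hf x).mem_nhds hz.2.2)).mdifferentiableAt (by simp)
    have h2 : MDifferentiableAt 𝓘(ℝ, E2) 𝓘(ℝ, E2) φ.symm z :=
      ((contMDiffOn_chart_symm (I := 𝓘(ℝ, E2)) (n := ∞) (x := q₀)).contMDiffAt
        (φ.open_target.mem_nhds hz.1)).mdifferentiableAt (by simp)
    rw [← mfderiv_eq_fderiv, hH, mfderiv_comp z h1 h2]
    rfl
  have harea := area_fderiv_eq_zero (hHs.contDiffAt (hZo.mem_nhds hz₀))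
    (Filter.eventually_of_mem (hZo.mem_nhds hz₀) fun z hz e => by
      rw [hfd z hz e]; exact hcon' _ hz.2 _)
  have hd : ∀ w : TangentSpace 𝓘(ℝ, E2) q₀, fderiv ℝ H (φ q₀) w = dInChart f x q₀ w := fun w => by
    have h1 : MDifferentiableAt 𝓘(ℝ, E2) 𝓘(ℝ, C3) (inChart f x) q₀ :=
      ((contMDiffOn_inChart hf x).contMDiffAt
        ((isOpen_chartDomain hf x).mem_nhds hx₀)).mdifferentiableAt (by simp)
    rw [dInChart, h1.mfderiv, ← fderivWithin_univ]
    simp [writtenInExtChartAt, hH, hφ]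
    rfl
  have harea' : area (dInChart f x q₀ (u q₀)) (dInChart f x q₀ (v q₀)) = 0 := by
    rw [← hd (u q₀), ← hd (v q₀)]
    exact harea _ _
  have hzero : area (push f q₀ (u q₀)) (push f q₀ (v q₀)) = 0 := by
    obtain ⟨c, hc, -, -, ha, -⟩ := exists_dParam_apply x (inChart f x q₀)
    rw [push_eq_dParam hf hx₀, push_eq_dParam hf hx₀, ha, hcon' q₀ ⟨hq₀, hx₀⟩,
      hcon' q₀ ⟨hq₀, hx₀⟩, harea']
    simp
  have hcol := (hf.isUnitaryPair (h.orthonormal q₀ hq₀)).column.1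
  rw [hu0 q₀ hq₀, hv0 q₀ hq₀, G_apply] at hcol
  simp [hzero] at hcol

end Legendrian

/-! ### Changes of phase and of frame. -/

section NormalForms

variable {M : Type*} [TopologicalSpace M] [ChartedSpace E2 M] [IsManifold 𝓘(ℝ, E2) ∞ M]
  {f : M → CP3} {N N' : Set M} {u v : ∀ q : M, TangentSpace 𝓘(ℝ, E2) q} {a b c a' b' c' : M → ℂ}

namespace IsFrameData

theorem mono (h : IsFrameData f N u v a b c) (hN' : IsOpen N') (hs : N' ⊆ N) :
    IsFrameData f N' u v a b c :=
  ⟨hN', ContMDiffOn.mono h.smooth_u hs, ContMDiffOn.mono h.smooth_v hs, h.smooth_a.mono hs,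
    h.smooth_b.mono hs, h.smooth_c.mono hs, fun q hq => h.orthonormal q (hs hq),
    fun q hq => h.phase q (hs hq)⟩

theorem shrink {F : Type*} [NormedAddCommGroup F] [NormedSpace ℝ F] {g : M → F} {s : Set F}
    (h : IsFrameData f N u v a b c) (hg : SmoothMapOn N g) (hs : IsOpen s) :
    IsFrameData f {q | q ∈ N ∧ g q ∈ s} u v a b c :=
  h.mono (hg.isOpen_preimage h.isOpen hs) fun _ hq => hq.1

theorem congr (h : IsFrameData f N u v a b c) (ha : ∀ q ∈ N, a' q = a q)
    (hb : ∀ q ∈ N, b' q = b q) (hc : ∀ q ∈ N, c' q = c q) : IsFrameData f N u v a' b' c' :=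
  ⟨h.isOpen, h.smooth_u, h.smooth_v, ContMDiffOn.congr h.smooth_a ha,
    ContMDiffOn.congr h.smooth_b hb, ContMDiffOn.congr h.smooth_c hc, h.orthonormal,
    fun q hq => by rw [ha q hq, hb q hq, hc q hq]; exact h.phase q hq⟩

theorem mul_phase (h : IsFrameData f N u v a b c) {e : M → ℂ} (he : SmoothMapOn N e)
    (h1 : ∀ q ∈ N, e q * star (e q) = 1) :
    IsFrameData f N u v (fun q => e q * a q) (fun q => e q * b q) (fun q => e q * c q) := by
  refine ⟨h.isOpen, h.smooth_u, h.smooth_v, he.mul h.smooth_a, he.mul h.smooth_b, he.mul h.smooth_c,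
    h.orthonormal, fun q hq => ?_⟩
  obtain ⟨e', he', e1, e2, e3⟩ := h.phase q hq
  have h1q := h1 q hq
  refine ⟨e' * star (e q), ?_, ?_, ?_, ?_⟩
  · rw [star_mul, star_star]; linear_combination e' * star e' * h1q + he'
  · rw [e1]; linear_combination -(e' * a q) * h1q
  · rw [e2]; linear_combination -(e' * b q) * h1q
  · rw [e3]; linear_combination -(e' * c q) * h1q

theorem nkMetric_combination (h : IsFrameData f N u v a b c) {q : M} (hq : q ∈ N) (p r s t : ℝ) :
    nkMetric (f q) (push f q (p • u q + r • v q)) (push f q (s • u q + t • v q)) =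
      p * s + r * t := by
  obtain ⟨h1, h2, h3⟩ := h.orthonormal q hq
  have h4 : nkMetric (f q) (push f q (v q)) (push f q (u q)) = 0 := by
    rw [nkMetric_eq_hermJ] at h3 ⊢
    rw [hermJ_conj]; simpa using h3
  simp only [push_add, push_smul, map_add, map_smul, add_apply, smul_apply, h1, h2, h3, h4]
  simp; ring

theorem G_combination (x : CP3) (U V : T x) (p r s t : ℝ) :
    G x (p • U + r • V) (s • U + t • V) 0 = (p * t - r * s : ℝ) * G x U V 0 := by
  rw [G_apply, G_apply]; simp [area]; ring

/-- An orthogonal change of frame acts linearly on `a, b`; since `G` is bilinear and alternating,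
`c` is multiplied by the determinant. -/
theorem linear (h : IsFrameData f N u v a b c) {p r s t : M → ℝ} (hp : SmoothMapOn N p)
    (hr : SmoothMapOn N r) (hs : SmoothMapOn N s) (ht : SmoothMapOn N t)
    (h1 : ∀ q ∈ N, p q * p q + r q * r q = 1) (h2 : ∀ q ∈ N, s q * s q + t q * t q = 1)
    (h3 : ∀ q ∈ N, p q * s q + r q * t q = 0) :
    IsFrameData f N (fun q => p q • u q + r q • v q) (fun q => s q • u q + t q • v q)
      (fun q => p q * a q + r q * b q) (fun q => s q * a q + t q * b q)
      (fun q => (p q * t q - r q * s q : ℝ) * c q) := by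
  refine ⟨h.isOpen, .add (.smul hp h.smooth_u) (.smul hr h.smooth_v),
    .add (.smul hs h.smooth_u) (.smul ht h.smooth_v),
    (hp.ofReal.mul h.smooth_a).add (hr.ofReal.mul h.smooth_b),
    (hs.ofReal.mul h.smooth_a).add (ht.ofReal.mul h.smooth_b),
    ((hp.mul ht).sub (hr.mul hs)).ofReal.mul h.smooth_c, fun q hq => ?_, fun q hq => ?_⟩
  · refine ⟨?_, ?_, ?_⟩ <;> rw [h.nkMetric_combination hq]
    exacts [h1 q hq, h2 q hq, h3 q hq]
  · obtain ⟨e, he, e1, e2, e3⟩ := h.phase q hq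
    refine ⟨e, he, ?_, ?_, ?_⟩
    · rw [push_add, push_smul, push_smul]; simp [e1, e2]; ring
    · rw [push_add, push_smul, push_smul]; simp [e1, e2]; ring
    · rw [push_add, push_add, push_smul, push_smul, push_smul, push_smul, G_combination, e3]; ring

theorem rotate (h : IsFrameData f N u v a b c) {p r : M → ℝ} (hp : SmoothMapOn N p)
    (hr : SmoothMapOn N r) (h1 : ∀ q ∈ N, p q * p q + r q * r q = 1) :
    IsFrameData f N (fun q => p q • u q + r q • v q) (fun q => (-r q) • u q + p q • v q)
      (fun q => p q * a q + r q * b q) (fun q => -r q * a q + p q * b q) c :=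
  (h.linear hp hr hr.neg hp h1 (fun q hq => by linarith [h1 q hq]) (fun q _ => by ring)).congr
    (fun q _ => rfl) (fun q _ => by push_cast; rfl) fun q hq => by
      rw [show p q * p q - r q * -r q = 1 by linarith [h1 q hq]]; simp

theorem reflect (h : IsFrameData f N u v a b c) :
    IsFrameData f N (fun q => (1 : ℝ) • u q + (0 : ℝ) • v q)
      (fun q => (0 : ℝ) • u q + (-1 : ℝ) • v q) a (fun q => -b q) (fun q => -c q) :=
  (h.linear (.const 1) (.const 0) (.const 0) (.const (-1)) (by simp) (by simp) (by simp)).congr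
    (by simp) (by simp) (by simp)

theorem sum_normSq (hf : IsTotallyReal f) (h : IsFrameData f N u v a b c) {q : M} (hq : q ∈ N) :
    ‖a q‖ ^ 2 + ‖b q‖ ^ 2 + ‖c q‖ ^ 2 = 1 := by
  obtain ⟨e, he, e1, e2, e3⟩ := h.phase q hq
  have hcol := (hf.isUnitaryPair (h.orthonormal q hq)).column.1
  rw [e1, e2, e3] at hcol
  have hn : ∀ z : ℂ, z * star z = ((‖z‖ ^ 2 : ℝ) : ℂ) := fun z => by
    rw [Complex.ofReal_pow]; exact Complex.mul_conj' z
  have h2 : a q * star (a q) + b q * star (b q) + c q * star (c q) = 1 := by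
    simp only [star_mul] at hcol
    linear_combination hcol - (a q * star (a q) + b q * star (b q) + c q * star (c q)) * he
  rw [hn, hn, hn] at h2
  exact_mod_cast h2

end IsFrameData

/-- A smooth frame for which the first components of `u`, `v`, `G(u, v)` are, up to a common phase,
`r > 0`, `i t` with `t ≥ 0`, and `c`. -/
structure IsReduced (f : M → CP3) (N : Set M) (u v : ∀ q : M, TangentSpace 𝓘(ℝ, E2) q)
    (r t : M → ℝ) (c : M → ℂ) : Prop where
  data : IsFrameData f N u v (fun q => r q) (fun q => Complex.I * t q) c
  smooth_r : SmoothMapOn N r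
  smooth_t : SmoothMapOn N t
  pos : ∀ q ∈ N, 0 < r q

theorem IsReduced.mono {r t : M → ℝ} (h : IsReduced f N u v r t c) (hN' : IsOpen N') (hs : N' ⊆ N) :
    IsReduced f N' u v r t c :=
  ⟨h.data.mono hN' hs, h.smooth_r.mono hs, h.smooth_t.mono hs, fun q hq => h.pos q (hs hq)⟩

theorem IsReduced.sum_sq (hf : IsTotallyReal f) {r t : M → ℝ} (h : IsReduced f N u v r t c) {q : M}
    (hq : q ∈ N) : r q ^ 2 + t q ^ 2 + ‖c q‖ ^ 2 = 1 := by
  have := h.data.sum_normSq hf hq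
  simpa using this

theorem IsReduced.hasCoefficients (hf : IsTotallyReal f) {r t : M → ℝ}
    (h : IsReduced f N u v r t c) {q : M} (hq : q ∈ N) {b₁ b₂ b₄ b₅ c₃ c₄ c₅ : ℝ}
    (h1 : b₁ = 2 * (r q * t q)) (h2 : b₂ = 1 - 2 * r q ^ 2)
    (h4 : b₄ = 2 * r q * (c q).im) (h5 : b₅ = -(2 * r q * (c q).re))
    (h3 : c₃ = 1 - 2 * t q ^ 2)
    (h6 : c₄ = -(2 * t q * (c q).re)) (h7 : c₅ = -(2 * t q * (c q).im)) :
    HasCoefficients (f q) (push f q (u q)) (push f q (v q)) b₁ b₂ b₄ b₅ c₃ c₄ c₅ := by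
  obtain ⟨e, he, e1, e2, e3⟩ := h.data.phase q hq
  have hc := Complex.re_add_im (c q)
  refine (hf.isUnitaryPair (h.data.orthonormal q hq)).hasCoefficients ?_ ?_ ?_ ?_ ?_
  · rw [e1, e2, h1]
    simp at he ⊢
    linear_combination 2 * (r q * t q : ℂ) * Complex.I ^ 2 * he +
      2 * (r q * t q : ℂ) * Complex.I_sq
  · rw [e1, h2]
    simp at he ⊢
    linear_combination (-(r q : ℂ) ^ 2) * he
  · rw [e1, e3, h4, h5]
    simp at he ⊢
    linear_combination (2 * Complex.I * (r q : ℂ) * c q) * he - 2 * Complex.I * (r q : ℂ) * hc +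
      2 * (r q : ℂ) * (c q).im * Complex.I_sq
  · rw [e2, h3]
    simp at he ⊢
    linear_combination (-2 * (t q : ℂ) ^ 2 * Complex.I ^ 2) * he - 2 * (t q : ℂ) ^ 2 * Complex.I_sq
  · rw [e2, e3, h6, h7]
    simp at he ⊢
    linear_combination (-2 * Complex.I ^ 2 * (t q : ℂ) * c q) * he - 2 * (t q : ℂ) * hc -
      2 * (t q : ℂ) * c q * Complex.I_sq

end NormalForms

/-! ### Reduction of the first components to `r`, `i t`, `c`. -/

section Reduction

variable {M : Type*} [TopologicalSpace M] [ChartedSpace E2 M] {N : Set M}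

theorem phase_mul_star {z : ℂ} (hz : z ≠ 0) : z / ‖z‖ * star (z / ‖z‖) = 1 := by
  have h : (‖z‖ : ℂ) ≠ 0 := by exact_mod_cast (norm_ne_zero_iff.2 hz)
  have h2 : z * star z = (‖z‖ : ℂ) ^ 2 := Complex.mul_conj' z
  rw [star_div₀, div_mul_div_comm, h2, Complex.star_def, Complex.conj_ofReal, sq, div_self]
  exact mul_ne_zero h h

theorem SmoothMapOn.phase {z : M → ℂ} (hz : SmoothMapOn N z) (h0 : ∀ q ∈ N, z q ≠ 0) :
    SmoothMapOn N (fun q => z q / (‖z q‖ : ℂ)) :=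
  hz.div (hz.norm h0).ofReal fun q hq => by exact_mod_cast (norm_ne_zero_iff.2 (h0 q hq))

variable [IsManifold 𝓘(ℝ, E2) ∞ M]
  {f : M → CP3} {u v : ∀ q : M, TangentSpace 𝓘(ℝ, E2) q} {a b c : M → ℂ}

/-- Where `a² + b²` is a positive real number the frame can be rotated to the axes of the ellipse that
is spanned by `a`, `b`. -/
theorem IsFrameData.exists_isReduced_of_pos (h : IsFrameData f N u v a b c)
    (him : ∀ q ∈ N, (a q ^ 2 + b q ^ 2).im = 0) (hre : ∀ q ∈ N, 0 < (a q ^ 2 + b q ^ 2).re) :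
    ∃ u v r t, IsReduced f N u v r t c ∧ ∀ q ∈ N, |t q| < r q := by
  set R : M → ℝ := fun q => √((a q).re * (a q).re + (b q).re * (b q).re) with hR
  have hpos : ∀ q ∈ N, 0 < (a q).re * (a q).re + (b q).re * (b q).re := fun q hq => by
    have := hre q hq
    simp [sq] at this
    nlinarith [sq_nonneg (a q).im, sq_nonneg (b q).im]
  have hRpos : ∀ q ∈ N, 0 < R q := fun q hq => Real.sqrt_pos.2 (hpos q hq)
  have hRR : ∀ q ∈ N, R q * R q = (a q).re * (a q).re + (b q).re * (b q).re := fun q hq =>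
    Real.mul_self_sqrt (hpos q hq).le
  have sar := h.smooth_a.re
  have sai := h.smooth_a.im
  have sbr := h.smooth_b.re
  have sbi := h.smooth_b.im
  have sR : SmoothMapOn N R :=
    ((sar.mul sar).add (sbr.mul sbr)).sqrt fun q hq => (hpos q hq).ne'
  have sp : SmoothMapOn N fun q => (a q).re / R q := sar.div sR fun q hq => (hRpos q hq).ne'
  have sq' : SmoothMapOn N fun q => (b q).re / R q := sbr.div sR fun q hq => (hRpos q hq).ne'
  set t : M → ℝ := fun q => ((a q).re * (b q).im - (b q).re * (a q).im) / R q with ht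
  have st : SmoothMapOn N t := ((sar.mul sbi).sub (sbr.mul sai)).div sR fun q hq => (hRpos q hq).ne'
  have hrot := h.rotate sp sq' fun q hq => by
    have h1 := hRR q hq
    have h2 := (hRpos q hq).ne'
    field_simp
    linarith
  -- The vectors `(Re a, Re b)` and `(Im a, Im b)` are orthogonal, so the rotation that brings the
  -- first to the first axis brings the second to the second axis.
  have him' : ∀ q ∈ N, (a q).re * (a q).im + (b q).re * (b q).im = 0 := fun q hq => by
    have := him q hq
    simp [sq] at this
    linarith
  refine ⟨_, _, R, t, ⟨hrot.congr (fun q hq => ?_) (fun q hq => ?_) (fun q _ => rfl), sR, st, hRpos⟩,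
    fun q hq => ?_⟩
  · have h1 := hRR q hq
    have h2 := (hRpos q hq).ne'
    have h3 := him' q hq
    apply Complex.ext
    · simp
      field_simp
      linarith
    · simp
      field_simp
      linarith
  · have h2 := (hRpos q hq).ne'
    apply Complex.ext
    · simp
      field_simp
      ring
    · simp [ht]
      field_simp
      ring
  · have h1 := hRR q hq
    have h2 := hRpos q hq
    have h3 := him' q hq
    have h4 := hre q hq
    simp [sq] at h4
    rw [← sq_lt_sq₀ (abs_nonneg _) h2.le, sq_abs]
    have h5 : t q * R q = (a q).re * (b q).im - (b q).re * (a q).im := by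
      simp only [ht]; field_simp
    have h6 : (t q * R q) ^ 2 = ((a q).im * (a q).im + (b q).im * (b q).im) * (R q * R q) := by
      rw [h5, h1]
      linear_combination -((a q).re * (a q).im + (b q).re * (b q).im) * h3
    have h7 : t q ^ 2 = (a q).im * (a q).im + (b q).im * (b q).im := by
      have : R q * R q ≠ 0 := (mul_pos h2 h2).ne'
      apply mul_right_cancel₀ this
      linear_combination h6
    rw [h7, sq, h1]
    linarith

/-- A smooth square root of the phase of `a² + b²` exists near `q₁`; dividing the components by it
makes `a² + b²` positive. -/
theorem IsFrameData.exists_isReduced_of_ne (h : IsFrameData f N u v a b c) {q₁ : M} (hq₁ : q₁ ∈ N)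
    (hne : a q₁ ^ 2 + b q₁ ^ 2 ≠ 0) : ∃ N' ⊆ N, N'.Nonempty ∧ ∃ u v r t c,
      IsReduced f N' u v r t c ∧ ∀ q ∈ N', |t q| < r q := by
  set D : M → ℂ := fun q => a q ^ 2 + b q ^ 2 with hD
  have hD₁ : D q₁ ≠ 0 := hne
  have sD : SmoothMapOn N D := by
    simp only [hD, sq]
    exact (h.smooth_a.mul h.smooth_a).add (h.smooth_b.mul h.smooth_b)
  set ρ : M → ℂ := fun q => D q / D q₁ with hρ
  have sρ : SmoothMapOn N ρ := sD.div (.const _) fun _ _ => hne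
  set N' : Set M := {q | q ∈ N ∧ ρ q ∈ Complex.slitPlane}
  have hN' : N' ⊆ N := fun q hq => hq.1
  have h' : IsFrameData f N' u v a b c := h.shrink sρ Complex.isOpen_slitPlane
  have sρ' := sρ.mono hN'
  obtain ⟨σ, hσ⟩ : ∃ σ : ℂ, σ ^ 2 = D q₁ := IsAlgClosed.exists_pow_nat_eq _ two_pos
  have hσ0 : σ ≠ 0 := fun h0 => hD₁ (by rw [← hσ, h0]; simp)
  have hρ0 : ∀ q ∈ N', ρ q ≠ 0 := fun q hq => Complex.slitPlane_ne_zero hq.2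
  have hpos : ∀ q ∈ N', 0 < (ρ q).re + ‖ρ q‖ := fun q hq => by
    rcases Complex.mem_slitPlane_iff.1 hq.2 with h1 | h1
    · linarith [norm_nonneg (ρ q)]
    · have := Complex.abs_re_lt_norm.2 h1
      linarith [neg_abs_le (ρ q).re]
  -- For `ρ` in the slit plane, `ρ + |ρ|` bisects the angle between `ρ` and the positive axis, so
  -- `κ²` is a positive multiple of `D`.
  set κ : M → ℂ := fun q => σ * (ρ q + ‖ρ q‖) with hκ
  have sκ : SmoothMapOn N' κ := (SmoothMapOn.const σ).mul (sρ'.add (sρ'.norm hρ0).ofReal)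
  have hnn : ∀ z : ℂ, z * star z = (‖z‖ : ℂ) ^ 2 := fun z => Complex.mul_conj' z
  have hκ2 : ∀ q, κ q ^ 2 = D q * (2 * ((ρ q).re + ‖ρ q‖) : ℝ) := fun q => by
    have h1 : D q = D q₁ * ρ q := by simp only [hρ]; field_simp
    have h2 : ρ q + star (ρ q) = (2 * (ρ q).re : ℝ) := Complex.add_conj _
    have h3 := hnn (ρ q)
    rw [h1, ← hσ]
    push_cast at h2 ⊢
    simp only [hκ]
    linear_combination σ ^ 2 * ρ q * h2 - σ ^ 2 * h3
  have hκ0 : ∀ q ∈ N', κ q ≠ 0 := fun q hq h0 => by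
    have h1 := hκ2 q
    rw [h0] at h1
    have hD0 : D q ≠ 0 := fun h2 => hρ0 q hq (by simp only [hρ, h2, zero_div])
    have h3 : ((2 * ((ρ q).re + ‖ρ q‖) : ℝ) : ℂ) ≠ 0 := by
      exact_mod_cast (mul_pos two_pos (hpos q hq)).ne'
    exact mul_ne_zero hD0 h3 (by rw [← h1]; simp)
  clear_value κ
  have hphase := h'.mul_phase (sκ.phase hκ0).conj fun q hq => by
    rw [star_star, mul_comm]; exact phase_mul_star (hκ0 q hq)
  have hval : ∀ q ∈ N', (star (κ q / ‖κ q‖) * a q) ^ 2 + (star (κ q / ‖κ q‖) * b q) ^ 2 =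
      (‖D q‖ ^ 2 * (2 * ((ρ q).re + ‖ρ q‖)) / ‖κ q‖ ^ 2 : ℝ) := fun q hq => by
    have hk : (‖κ q‖ : ℂ) ≠ 0 := by exact_mod_cast (norm_ne_zero_iff.2 (hκ0 q hq))
    have h1 := congrArg (starRingEnd ℂ) (hκ2 q)
    rw [map_pow, map_mul, Complex.conj_ofReal] at h1
    have h2 := hnn (D q)
    rw [Complex.star_def] at h2
    rw [star_div₀, Complex.star_def, Complex.conj_ofReal]
    push_cast at h1 ⊢
    field_simp
    rw [← h2]
    simp only [hD] at h1 ⊢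
    linear_combination (a q ^ 2 + b q ^ 2) * h1
  obtain ⟨u', v', r, t, hred, hlt⟩ := hphase.exists_isReduced_of_pos
    (fun q hq => by rw [hval q hq, Complex.ofReal_im]) (fun q hq => by
      rw [hval q hq, Complex.ofReal_re]
      have hD0 : D q ≠ 0 := fun h2 => hρ0 q hq (by simp only [hρ, h2, zero_div])
      have h1 := norm_pos_iff.2 hD0
      have h2 := norm_pos_iff.2 (hκ0 q hq)
      have h3 := hpos q hq
      positivity)
  refine ⟨N', hN', ⟨q₁, hq₁, ?_⟩, u', v', r, t, _, hred, hlt⟩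
  have : ρ q₁ = 1 := by simp only [hρ]; exact div_self hne
  rw [this]
  exact Complex.one_mem_slitPlane

/-- When `b = i a` the ellipse is a circle and no rotation is needed; removing the phase of `a`
suffices. -/
theorem IsFrameData.exists_isReduced_of_eq (h : IsFrameData f N u v a b c)
    (hb : ∀ q ∈ N, b q = Complex.I * a q) (ha : ∀ q ∈ N, a q ≠ 0) :
    ∃ r c, IsReduced f N u v r r c := by
  have hphase := h.mul_phase (h.smooth_a.phase ha).conj fun q hq => by
    rw [star_star, mul_comm]; exact phase_mul_star (ha q hq)
  have hval : ∀ q ∈ N, star (a q / ‖a q‖) * a q = ‖a q‖ := fun q hq => by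
    have hk : (‖a q‖ : ℂ) ≠ 0 := by exact_mod_cast (norm_ne_zero_iff.2 (ha q hq))
    have h1 : a q * (starRingEnd ℂ) (a q) = (‖a q‖ : ℂ) ^ 2 := Complex.mul_conj' (a q)
    rw [star_div₀, Complex.star_def, Complex.conj_ofReal]
    field_simp
    linear_combination h1
  refine ⟨fun q => ‖a q‖, _, hphase.congr (fun q hq => (hval q hq).symm) (fun q hq => ?_)
    (fun q _ => rfl), h.smooth_a.norm ha, h.smooth_a.norm ha, fun q hq => norm_pos_iff.2 (ha q hq)⟩
  rw [hb q hq]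
  linear_combination -Complex.I * hval q hq

/-- A reduced frame on a smaller open set: either `|t| < r` or `t = r`. -/
theorem IsFrameData.exists_isReduced (hf : IsTotallyReal f) (h : IsFrameData f N u v a b c)
    (hN : N.Nonempty) : ∃ N' ⊆ N, N'.Nonempty ∧ ∃ u v r t c, IsReduced f N' u v r t c ∧
      ((∀ q ∈ N', |t q| < r q) ∨ ∀ q ∈ N', t q = r q) := by
  by_cases hD : ∃ q ∈ N, a q ^ 2 + b q ^ 2 ≠ 0
  · obtain ⟨q₁, hq₁, hne⟩ := hD
    obtain ⟨N', hs, hn, u, v, r, t, c, h1, h2⟩ := h.exists_isReduced_of_ne hq₁ hne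
    exact ⟨N', hs, hn, u, v, r, t, c, h1, .inl h2⟩
  push Not at hD
  obtain ⟨q₁, hq₁, hne⟩ := h.exists_ne_zero hf hN
  have hab : ∀ q ∈ N, (b q - Complex.I * a q) * (b q + Complex.I * a q) = 0 := fun q hq => by
    linear_combination hD q hq - a q ^ 2 * Complex.I_sq
  have ha₁ : a q₁ ≠ 0 := fun h0 => by
    have h1 := hD q₁ hq₁
    rw [h0] at h1
    have h2 : b q₁ = 0 := by simpa using h1
    exact hne.elim (· h0) (· h2)
  set N₁ : Set M := {q | q ∈ N ∧ a q ∈ ({0}ᶜ : Set ℂ)}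
  have h₁ : IsFrameData f N₁ u v a b c := h.shrink h.smooth_a isOpen_compl_singleton
  have ha : ∀ q ∈ N₁, a q ≠ 0 := fun q hq => hq.2
  have hq₁' : q₁ ∈ N₁ := ⟨hq₁, ha₁⟩
  -- `Im (b / a)` takes only the values `1` and `-1` here, so its sign selects the branch `b = i a`
  -- or `b = -i a` on an open set.
  have ss : SmoothMapOn N₁ fun q => (b q / a q).im := (h₁.smooth_b.div h₁.smooth_a ha).im
  have hcase : ∀ q ∈ N₁, b q = Complex.I * a q ∨ b q = -(Complex.I * a q) := fun q hq =>
    (mul_eq_zero.1 (hab q hq.1)).imp sub_eq_zero.1 eq_neg_of_add_eq_zero_left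
  have him₁ : ∀ q ∈ N₁, b q = Complex.I * a q → (b q / a q).im = 1 := fun q hq hb => by
    rw [hb, mul_div_cancel_right₀ _ (ha q hq), Complex.I_im]
  have him₂ : ∀ q ∈ N₁, b q = -(Complex.I * a q) → (b q / a q).im = -1 := fun q hq hb => by
    rw [hb, neg_div, mul_div_cancel_right₀ _ (ha q hq), Complex.neg_im, Complex.I_im]
  rcases hcase q₁ hq₁' with h0 | h0
  · obtain ⟨r, c', hr⟩ := (h₁.shrink ss (isOpen_Ioi (a := 0))).exists_isReduced_of_eq
      (fun q hq => (hcase q hq.1).resolve_right fun h2 => by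
        have h3 : 0 < (b q / a q).im := hq.2
        linarith [him₂ q hq.1 h2]) (fun q hq => ha q hq.1)
    refine ⟨{q | q ∈ N₁ ∧ (b q / a q).im ∈ Set.Ioi 0}, fun q hq => hq.1.1, ⟨q₁, hq₁', ?_⟩, u, v, r, r, c', hr, .inr fun _ _ => rfl⟩
    simp [him₁ q₁ hq₁' h0]
  · obtain ⟨r, c', hr⟩ := (h₁.shrink ss (isOpen_Iio (a := 0))).reflect.exists_isReduced_of_eq
      (fun q hq => by
        have h3 : (b q / a q).im < 0 := hq.2
        rw [(hcase q hq.1).resolve_left fun h2 => by linarith [him₁ q hq.1 h2], neg_neg])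
      (fun q hq => ha q hq.1)
    refine ⟨{q | q ∈ N₁ ∧ (b q / a q).im ∈ Set.Iio 0}, fun q hq => hq.1.1, ⟨q₁, hq₁', ?_⟩, _, _, r, r, c', hr, .inr fun _ _ => rfl⟩
    simp [him₂ q₁ hq₁' h0]

theorem IsReduced.reflect {r t : M → ℝ} (h : IsReduced f N u v r t c) :
    IsReduced f N (fun q => (1 : ℝ) • u q + (0 : ℝ) • v q)
      (fun q => (0 : ℝ) • u q + (-1 : ℝ) • v q) r (fun q => -t q) (fun q => -c q) :=
  ⟨h.data.reflect.congr (fun _ _ => rfl) (fun q _ => by simp) fun _ _ => rfl, h.smooth_r,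
    h.smooth_t.neg, h.pos⟩

/-- A reflection changes the sign of `t`, so after shrinking `t` is either positive throughout or
identically zero. The uniform alternative is needed for the smoothness of `α` in Type 2. -/
theorem exists_isReduced_nonneg (hf : IsTotallyReal f) (h : IsFrameData f N u v a b c)
    (hN : N.Nonempty) : ∃ N' ⊆ N, N'.Nonempty ∧ ∃ u v r t c, IsReduced f N' u v r t c ∧
      ((∀ q ∈ N', t q < r q) ∨ ∀ q ∈ N', t q = r q) ∧
      ((∀ q ∈ N', 0 < t q) ∨ ∀ q ∈ N', t q = 0) := by
  obtain ⟨N₁, hs, hn, u, v, r, t, c, h1, h2⟩ := h.exists_isReduced hf hN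
  rcases h2 with h2 | h2
  · by_cases ht : ∃ q ∈ N₁, t q ≠ 0
    · obtain ⟨q₁, hq₁, hne⟩ := ht
      rcases hne.lt_or_gt with h3 | h3
      · have ho := h1.smooth_t.isOpen_preimage h1.data.isOpen (isOpen_Iio (a := 0))
        refine ⟨{q | q ∈ N₁ ∧ t q ∈ Set.Iio 0}, fun q hq => hs hq.1, ⟨q₁, hq₁, h3⟩, _, _, r, _, _,
          (h1.mono ho fun q hq => hq.1).reflect, .inl fun q hq => ?_, .inl fun q hq => ?_⟩
        · exact (neg_le_abs _).trans_lt (h2 q hq.1)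
        · exact neg_pos.2 hq.2
      · have ho := h1.smooth_t.isOpen_preimage h1.data.isOpen (isOpen_Ioi (a := 0))
        exact ⟨{q | q ∈ N₁ ∧ t q ∈ Set.Ioi 0}, fun q hq => hs hq.1, ⟨q₁, hq₁, h3⟩, _, _, r, _, _, h1.mono ho fun q hq => hq.1,
          .inl fun q hq => (le_abs_self _).trans_lt (h2 q hq.1), .inl fun q hq => hq.2⟩
    · push Not at ht
      exact ⟨N₁, hs, hn, u, v, r, t, c, h1,
        .inl fun q hq => (le_abs_self _).trans_lt (h2 q hq), .inr ht⟩
  · exact ⟨N₁, hs, hn, u, v, r, t, c, h1, .inr h2, .inl fun q hq => by rw [h2 q hq]; exact h1.pos q hq⟩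

end Reduction

/-! ### The three normal forms. -/

section Classification

variable {M : Type*} [TopologicalSpace M] [ChartedSpace E2 M] {N : Set M}

theorem SmoothMapOn.arcsin {a : M → ℝ} (ha : SmoothMapOn N a) (h : ∀ q ∈ N, -1 < a q ∧ a q < 1) :
    SmoothMapOn N fun q => Real.arcsin (a q) :=
  ha.comp fun q hq => Real.contDiffAt_arcsin (h q hq).1.ne' (h q hq).2.ne

theorem SmoothMapOn.arg {z : M → ℂ} (hz : SmoothMapOn N z) (h : ∀ q ∈ N, z q ∈ Complex.slitPlane) :
    SmoothMapOn N fun q => (z q).arg := by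
  have h1 : SmoothMapOn N fun q => Complex.log (z q) := hz.comp fun q hq =>
    (Complex.contDiffAt_log (n := ∞) (h q hq)).restrict_scalars ℝ
  simpa only [Complex.log_im] using h1.im

variable [IsManifold 𝓘(ℝ, E2) ∞ M] {f : M → CP3} {u v : ∀ q : M, TangentSpace 𝓘(ℝ, E2) q} {r t : M → ℝ} {c : M → ℂ}

/-- On `N` there is a smooth adapted frame for which `J_∘` has one of the three normal forms. -/
def HasNormalForm (f : M → CP3) (N : Set M) : Prop :=
  ∃ u v : ∀ q : M, TangentSpace 𝓘(ℝ, E2) q, SmoothFieldOn N u ∧ SmoothFieldOn N v ∧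
    (∀ q ∈ N, IsAdaptedFrame (f q) (push f q (u q)) (push f q (v q))) ∧
    (∀ q ∈ N, fsMetric (f q) (push f q (u q)) (push f q (v q)) = 0) ∧
    ((∃ l α θ : M → ℝ, SmoothFunOn N l ∧ SmoothFunOn N α ∧ SmoothFunOn N θ ∧
        ∀ q ∈ N, 0 ≤ l q ∧ Type0 (f q) (push f q (u q)) (push f q (v q)) (l q) (α q) (θ q)) ∨
      (∀ q ∈ N, Type1 (f q) (push f q (u q)) (push f q (v q))) ∨
      (∃ α : M → ℝ, SmoothFunOn N α ∧
        ∀ q ∈ N, 0 ≤ Real.cos (α q) ∧ Type2 (f q) (push f q (u q)) (push f q (v q)) (α q)))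

/-- The product `ā b` is `i r t`, purely imaginary, and `g_∘(U, V)` is half its real part. -/
theorem IsReduced.adapted (hf : IsTotallyReal f) (h : IsReduced f N u v r t c) :
    (∀ q ∈ N, IsAdaptedFrame (f q) (push f q (u q)) (push f q (v q))) ∧
    (∀ q ∈ N, fsMetric (f q) (push f q (u q)) (push f q (v q)) = 0) := by
  refine ⟨fun q hq => (hf.isUnitaryPair (h.data.orthonormal q hq)).isAdaptedFrame, fun q hq => ?_⟩
  obtain ⟨e, he, e1, e2, -⟩ := h.data.phase q hq
  have h1 : star (e * (r q : ℂ)) * (e * (Complex.I * t q)) = (r q * t q : ℝ) * Complex.I := by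
    simp at he ⊢
    linear_combination (r q * t q : ℂ) * Complex.I * he
  rw [(hf.isUnitaryPair (h.data.orthonormal q hq)).fsMetric_eq, e1, e2, h1]
  simp

/-- Here `r² + t² = 1`, so `sin α = 1 - 2 r²` and `cos α = 2 r t` define an angle. -/
theorem IsReduced.type2 (hf : IsTotallyReal f) (h : IsReduced f N u v r t c)
    (ht : (∀ q ∈ N, 0 < t q) ∨ ∀ q ∈ N, t q = 0) (hc : ∀ q ∈ N, c q = 0) : HasNormalForm f N := by
  have hsum : ∀ q ∈ N, r q ^ 2 + t q ^ 2 = 1 := fun q hq => by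
    have := h.sum_sq hf hq
    rw [hc q hq] at this
    simpa using this
  have hnn : ∀ q ∈ N, 0 ≤ t q := fun q hq =>
    ht.elim (fun h1 => (h1 q hq).le) fun h1 => (h1 q hq).ge
  refine ⟨u, v, h.data.smooth_u, h.data.smooth_v, (h.adapted hf).1, (h.adapted hf).2, .inr (.inr
    ⟨fun q => Real.arcsin (1 - 2 * r q ^ 2), ?_, fun q hq => ⟨Real.cos_arcsin_nonneg _, ?_⟩⟩)⟩
  · rcases ht with ht | ht
    · have h2 : SmoothMapOn N fun q => 1 - 2 * r q ^ 2 := by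
        simp only [sq]
        exact (SmoothMapOn.const 1).sub ((SmoothMapOn.const 2).mul (h.smooth_r.mul h.smooth_r))
      refine h2.arcsin fun q hq => ?_
      have h3 := hsum q hq
      have h4 := pow_pos (ht q hq) 2
      have h5 := pow_pos (h.pos q hq) 2
      constructor <;> linarith
    · refine ContMDiffOn.congr (SmoothMapOn.const (Real.arcsin (-1))) fun q hq => ?_
      have h3 := hsum q hq
      rw [ht q hq] at h3
      congr 1
      linarith
  · have h3 := hsum q hq
    have h4 := sq_nonneg (t q)
    have h5 := sq_nonneg (r q)
    have hsin : Real.sin (Real.arcsin (1 - 2 * r q ^ 2)) = 1 - 2 * r q ^ 2 :=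
      Real.sin_arcsin (by linarith) (by linarith)
    have hcos : Real.cos (Real.arcsin (1 - 2 * r q ^ 2)) = 2 * (r q * t q) := by
      rw [Real.cos_arcsin, show 1 - (1 - 2 * r q ^ 2) ^ 2 = (2 * (r q * t q)) ^ 2 by
        linear_combination (-(4 * r q ^ 2)) * h3]
      exact Real.sqrt_sq (mul_nonneg two_pos.le (mul_nonneg (h.pos q hq).le (hnn q hq)))
    refine h.hasCoefficients hf hq hcos hsin ?_ ?_ ?_ ?_ ?_
    · simp [hc q hq]
    · simp [hc q hq]
    · rw [hsin]; linarith
    · simp [hc q hq]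
    · simp [hc q hq]

/-- For `a = r`, `b = i r` a rotation of the frame only multiplies `a, b` by a phase. Undoing that
phase restores `a, b` and turns `c`, which can thus be made `i |c|`. -/
theorem IsReduced.type1 (hf : IsTotallyReal f) (h : IsReduced f N u v r t c)
    (ht : ∀ q ∈ N, t q = r q) (hc : ∀ q ∈ N, ‖c q‖ ^ 2 = 1 / 2) : HasNormalForm f N := by
  have hr : ∀ q ∈ N, r q = 1 / 2 := fun q hq => by
    have h1 := h.sum_sq hf hq
    rw [ht q hq, hc q hq] at h1
    nlinarith [h.pos q hq]
  have hc0 : ∀ q ∈ N, c q ≠ 0 := fun q hq h0 => by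
    have := hc q hq
    rw [h0] at this
    norm_num at this
  have hn : ∀ q ∈ N, ‖c q‖ = 1 / √2 := fun q hq => by
    rw [← Real.sqrt_sq (norm_nonneg (c q)), hc q hq, Real.sqrt_div zero_le_one, Real.sqrt_one]
  -- Chosen so that `z̄ c = i |c|`.
  set z : M → ℂ := fun q => -Complex.I * (c q / ‖c q‖) with hz
  have sz : SmoothMapOn N z := (SmoothMapOn.const _).mul (h.data.smooth_c.phase hc0)
  have hz1 : ∀ q ∈ N, z q * star (z q) = 1 := fun q hq => by
    have h1 := phase_mul_star (hc0 q hq)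
    simp only [hz, star_mul, star_neg]
    have h2 : star Complex.I = -Complex.I := Complex.conj_I
    rw [h2]
    linear_combination h1 - (c q / ‖c q‖) * star (c q / ‖c q‖) * Complex.I_sq
  have hre : ∀ q, ((z q).re : ℂ) + (z q).im * Complex.I = z q := fun q => Complex.re_add_im _
  have hd := (h.data.rotate sz.re sz.im fun q hq => by
    have h1 := congrArg Complex.re (hz1 q hq)
    simpa using h1).mul_phase sz.conj fun q hq => by rw [star_star, mul_comm]; exact hz1 q hq
  have hred := hd.congr (a' := fun q => (r q : ℂ)) (b' := fun q => Complex.I * (r q : ℝ))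
    (c' := fun q => Complex.I * (‖c q‖ : ℝ)) (fun q hq => by
      simp only [ht q hq]
      linear_combination (-(r q : ℂ)) * hz1 q hq - star (z q) * r q * hre q)
    (fun q hq => by
      simp only [ht q hq]
      linear_combination (-(Complex.I * r q : ℂ)) * hz1 q hq -
        star (z q) * r q * Complex.I * hre q + star (z q) * r q * (z q).im * Complex.I_sq)
    (fun q hq => by
      have h2 : star Complex.I = -Complex.I := Complex.conj_I
      have h3 : c q * star (c q) = (‖c q‖ : ℂ) ^ 2 := Complex.mul_conj' (c q)
      have h4 : (‖c q‖ : ℂ) ≠ 0 := by exact_mod_cast (norm_ne_zero_iff.2 (hc0 q hq))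
      have h5 : star (‖c q‖ : ℂ) = ‖c q‖ := Complex.conj_ofReal _
      simp only [hz, star_mul, star_neg, h2, star_div₀, h5]
      field_simp
      linear_combination -h3)
  have hR : IsReduced f N _ _ r r _ := ⟨hred, h.smooth_r, h.smooth_r, h.pos⟩
  refine ⟨_, _, hR.data.smooth_u, hR.data.smooth_v, (hR.adapted hf).1, (hR.adapted hf).2,
    .inr (.inl fun q hq => ?_)⟩
  have hcre : (Complex.I * (‖c q‖ : ℂ)).re = 0 := by simp
  have hcim : (Complex.I * (‖c q‖ : ℂ)).im = 1 / √2 := by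
    rw [Complex.I_mul_im, Complex.ofReal_re, hn q hq]
  apply hR.hasCoefficients hf hq <;> simp only [hr q hq, hcre, hcim] <;> ring

/-- With `λ = t / r` and `sin α = 2 |c|² - 1`, the relation `r² + t² + |c|² = 1` gives `cos α / √(1
+ λ²) = 2 r |c|`; the angle `θ` records the phase of `c`. The hypothesis `hne` rules out the
excluded pair `λ = 1`, `α = 0`. -/
theorem IsReduced.type0 (hf : IsTotallyReal f) (h : IsReduced f N u v r t c) (hN : N.Nonempty)
    (ht : ∀ q ∈ N, 0 ≤ t q) (hc : ∀ q ∈ N, c q ≠ 0)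
    (hne : ∀ q ∈ N, t q = r q → ‖c q‖ ^ 2 ≠ 1 / 2) :
    ∃ N' ⊆ N, IsOpen N' ∧ N'.Nonempty ∧ HasNormalForm f N' := by
  obtain ⟨q₁, hq₁⟩ := hN
  have hc₁ := hc q₁ hq₁
  have sρ : SmoothMapOn N fun q => c q / c q₁ := h.data.smooth_c.div (.const _) fun _ _ => hc₁
  have ho := sρ.isOpen_preimage h.data.isOpen Complex.isOpen_slitPlane
  set N' : Set M := {q | q ∈ N ∧ c q / c q₁ ∈ Complex.slitPlane}
  have hs : N' ⊆ N := fun q hq => hq.1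
  refine ⟨N', hs, ho, ⟨q₁, hq₁, by rw [div_self hc₁]; exact Complex.one_mem_slitPlane⟩, ?_⟩
  have h' := h.mono ho hs
  set l : M → ℝ := fun q => t q / r q with hl
  set s : M → ℝ := fun q => 2 * ‖c q‖ ^ 2 - 1 with hs'
  -- A branch of `-arg (-c)` that is smooth on `N'`: only the argument of `c / c q₁`, which stays in
  -- the slit plane, varies.
  set θ : M → ℝ := fun q => -((c q / c q₁).arg + (-c q₁).arg) with hθ
  have hsb : ∀ q ∈ N, -1 < s q ∧ s q < 1 := fun q hq => by
    have h1 := h.sum_sq hf hq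
    have h2 := pow_pos (norm_pos_iff.2 (hc q hq)) 2
    have h3 := pow_pos (h.pos q hq) 2
    have h4 := sq_nonneg (t q)
    simp only [hs']
    constructor <;> linarith
  have sl : SmoothMapOn N' l := h'.smooth_t.div h'.smooth_r fun q hq => (h'.pos q hq).ne'
  have ss : SmoothMapOn N' s := by
    have h1 := (h'.data.smooth_c.norm fun q hq => hc q (hs hq))
    simp only [hs', sq]
    exact ((SmoothMapOn.const 2).mul (h1.mul h1)).sub (.const 1)
  have sα := ss.arcsin fun q hq => hsb q (hs hq)
  have sθ : SmoothMapOn N' θ := (((sρ.mono hs).arg fun q hq => hq.2).add (.const _)).neg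
  refine ⟨u, v, h'.data.smooth_u, h'.data.smooth_v, (h'.adapted hf).1, (h'.adapted hf).2,
    .inl ⟨l, fun q => Real.arcsin (s q), θ, sl, sα, sθ, fun q hq => ⟨?_, ?_, ?_, ?_⟩⟩⟩
  · exact div_nonneg (ht q hq.1) (h.pos q hq.1).le
  · exact ⟨Real.neg_pi_div_two_lt_arcsin.2 (hsb q hq.1).1, Real.arcsin_lt_pi_div_two.2 (hsb q hq.1).2⟩
  · rintro ⟨h1, h2⟩
    have hr := h.pos q hq.1
    have htn := ht q hq.1
    have h3 : t q = r q := by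
      simp only [hl] at h1
      field_simp at h1
      nlinarith
    refine hne q hq.1 h3 ?_
    have h4 : s q = 0 := Real.arcsin_eq_zero_iff.1 h2
    simp only [hs'] at h4
    linarith
  have hr := h.pos q hq.1
  have hsum := h.sum_sq hf hq.1
  set n := ‖c q‖ with hn
  have hnpos : 0 < n := norm_pos_iff.2 (hc q hq.1)
  have hsin : Real.sin (Real.arcsin (s q)) = 2 * n ^ 2 - 1 :=
    Real.sin_arcsin (hsb q hq.1).1.le (hsb q hq.1).2.le
  have hlpos : 0 < 1 + l q ^ 2 := by positivity
  have hlr : l q * r q = t q := by simp only [hl]; field_simp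
  have hcos : Real.cos (Real.arcsin (s q)) / √(1 + l q ^ 2) = 2 * (r q * n) := by
    rw [div_eq_iff (Real.sqrt_pos.2 hlpos).ne', Real.cos_arcsin,
      show 1 - s q ^ 2 = (2 * (r q * n)) ^ 2 * (1 + l q ^ 2) by
        simp only [hs', ← hn]
        linear_combination (-(4 * n ^ 2)) * hsum - (4 * n ^ 2) * (l q * r q + t q) * hlr,
      Real.sqrt_mul (sq_nonneg _), Real.sqrt_sq (by positivity)]
  have hexp : (n : ℂ) * (Real.cos (θ q) - Real.sin (θ q) * Complex.I) = -c q := by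
    have h1 := Complex.norm_mul_exp_arg_mul_I (c q / c q₁)
    have h2 := Complex.norm_mul_exp_arg_mul_I (-c q₁)
    have h3 : (Real.cos (θ q) - Real.sin (θ q) * Complex.I : ℂ) =
        Complex.exp ((c q / c q₁).arg * Complex.I) * Complex.exp ((-c q₁).arg * Complex.I) := by
      rw [← Complex.exp_add, ← add_mul, ← Complex.ofReal_add, Complex.exp_mul_I]
      simp only [hθ, Real.cos_neg, Real.sin_neg, Complex.ofReal_cos, Complex.ofReal_sin,
        Complex.ofReal_neg]
      ring
    have h4 : (n : ℂ) = ‖c q / c q₁‖ * ‖-c q₁‖ := by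
      rw [norm_div, norm_neg, ← Complex.ofReal_mul, div_mul_cancel₀ _ (norm_ne_zero_iff.2 hc₁)]
    rw [h3, h4, mul_mul_mul_comm, h1, h2]
    field_simp
  have hre : n * Real.cos (θ q) = -(c q).re := by
    have := congrArg Complex.re hexp
    simpa [-Complex.ofReal_cos, -Complex.ofReal_sin] using this
  have him : n * Real.sin (θ q) = (c q).im := by
    have := congrArg Complex.im hexp
    simp [-Complex.ofReal_cos, -Complex.ofReal_sin] at this
    linarith
  refine h.hasCoefficients hf hq.1 ?_ ?_ ?_ ?_ ?_ ?_ ?_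
  · rw [hsin, div_mul_eq_mul_div, div_eq_iff hlpos.ne']
    linear_combination (-2 * l q) * hsum + (2 * r q - 2 * t q * l q) * hlr
  · rw [hsin, div_eq_iff hlpos.ne']
    linear_combination 2 * hsum + 2 * (l q * r q + t q) * hlr
  · rw [mul_div_right_comm, hcos]; linear_combination 2 * r q * him
  · rw [mul_div_right_comm, hcos]; linear_combination 2 * r q * hre
  · rw [hsin, div_eq_iff hlpos.ne']
    linear_combination 2 * l q ^ 2 * hsum - 2 * (l q * r q + t q) * hlr
  · rw [mul_assoc, mul_div_assoc, mul_div_right_comm, hcos]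
    linear_combination 2 * l q * r q * hre - 2 * (c q).re * hlr
  · rw [mul_assoc, mul_div_assoc, mul_div_right_comm, hcos]
    linear_combination -2 * l q * r q * him - 2 * (c q).im * hlr

theorem exists_hasNormalForm (hf : IsTotallyReal f) {O : Set M} (hO : IsOpen O) (hne : O.Nonempty) :
    ∃ N ⊆ O, IsOpen N ∧ N.Nonempty ∧ HasNormalForm f N := by
  obtain ⟨q₀, hq₀⟩ := hne
  obtain ⟨N₀, u, v, a, b, c, hq₀', hd⟩ := exists_isFrameData hf q₀
  have hd' := hd.mono (hd.isOpen.inter hO) Set.inter_subset_left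
  obtain ⟨N, hs, hn, u, v, r, t, c, h, h1, h2⟩ := exists_isReduced_nonneg hf hd' ⟨q₀, hq₀', hq₀⟩
  have hsO : N ⊆ O := hs.trans Set.inter_subset_right
  have hnn : ∀ q ∈ N, 0 ≤ t q := fun q hq =>
    h2.elim (fun h1 => (h1 q hq).le) fun h1 => (h1 q hq).ge
  by_cases hc : ∃ q ∈ N, c q ≠ 0
  swap
  · push Not at hc
    exact ⟨N, hsO, h.data.isOpen, hn, h.type2 hf h2 hc⟩
  obtain ⟨q₁, hq₁, hc₁⟩ := hc
  have ho := h.data.smooth_c.isOpen_preimage h.data.isOpen (isOpen_compl_singleton (x := 0))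
  set N₁ : Set M := {q | q ∈ N ∧ c q ∈ ({0}ᶜ : Set ℂ)}
  have hs₁ : N₁ ⊆ N := fun q hq => hq.1
  have h' := h.mono ho hs₁
  have hn₁ : N₁.Nonempty := ⟨q₁, hq₁, hc₁⟩
  rcases h1 with h1 | h1
  · obtain ⟨N', e1, e2, e3, e4⟩ := h'.type0 hf hn₁ (fun q hq => hnn q hq.1) (fun q hq => hq.2)
      fun q hq h3 => absurd h3 (h1 q hq.1).ne
    exact ⟨N', (e1.trans hs₁).trans hsO, e2, e3, e4⟩
  -- On the locus `t = r`, Type 0 needs `|c|² ≠ 1/2`; this holds on some nonempty open subset unless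
  -- `|c|² = 1/2` throughout, which is Type 1.
  by_cases hc2 : ∃ q ∈ N₁, ‖c q‖ ^ 2 ≠ 1 / 2
  · obtain ⟨q₂, hq₂, hne₂⟩ := hc2
    have sn : SmoothMapOn N₁ fun q => ‖c q‖ ^ 2 := by
      have h3 := h'.data.smooth_c.norm fun q hq => hq.2
      simp only [sq]
      exact h3.mul h3
    have ho₂ := sn.isOpen_preimage ho (isOpen_compl_singleton (x := (1 / 2 : ℝ)))
    obtain ⟨N', e1, e2, e3, e4⟩ := (h'.mono ho₂ fun q hq => hq.1).type0 hf ⟨q₂, hq₂, hne₂⟩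
      (fun q hq => hnn q hq.1.1) (fun q hq => hq.1.2) fun q hq _ => hq.2
    exact ⟨N', fun q hq => hsO (e1 hq).1.1, e2, e3, e4⟩
  · push Not at hc2
    exact ⟨N₁, hs₁.trans hsO, ho, hn₁, h'.type1 hf (fun q hq => h1 q hq.1) hc2⟩

end Classification
end
end CP3

theorem mainTheorem8 {M : Type*} [TopologicalSpace M] [ChartedSpace CP3.E2 M]
    [IsManifold 𝓘(ℝ, CP3.E2) ∞ M] (f : M → CP3) (hf : CP3.IsTotallyReal f) :
    (∃ W : Set M, IsOpen W ∧ Dense W ∧ ∀ q₀ ∈ W, ∃ N ⊆ W, IsOpen N ∧ q₀ ∈ N ∧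
      ∃ u v : ∀ q : M, TangentSpace 𝓘(ℝ, CP3.E2) q,
        CP3.SmoothFieldOn N u ∧ CP3.SmoothFieldOn N v ∧
        (∀ q ∈ N, CP3.IsAdaptedFrame (f q) (CP3.push f q (u q)) (CP3.push f q (v q))) ∧
        (∀ q ∈ N, CP3.fsMetric (f q) (CP3.push f q (u q)) (CP3.push f q (v q)) = 0) ∧
        ((∃ l α θ : M → ℝ, CP3.SmoothFunOn N l ∧ CP3.SmoothFunOn N α ∧ CP3.SmoothFunOn N θ ∧
            ∀ q ∈ N, 0 ≤ l q ∧ CP3.Type0 (f q) (CP3.push f q (u q)) (CP3.push f q (v q)) (l q) (α q) (θ q)) ∨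
          (∀ q ∈ N, CP3.Type1 (f q) (CP3.push f q (u q)) (CP3.push f q (v q))) ∨
          (∃ α : M → ℝ, CP3.SmoothFunOn N α ∧
            ∀ q ∈ N, 0 ≤ Real.cos (α q) ∧ CP3.Type2 (f q) (CP3.push f q (u q)) (CP3.push f q (v q)) (α q)))) ∧
    ∀ q : M, ¬ (CP3.IsType0At f q ∧ CP3.IsType1At f q) ∧ ¬ (CP3.IsType0At f q ∧ CP3.IsType2At f q) ∧
      ¬ (CP3.IsType1At f q ∧ CP3.IsType2At f q) := by
  -- `W` is the union of all open sets that carry a normal form; it is dense because every nonempty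
  -- open set contains a nonempty one of them.
  refine ⟨⟨⋃₀ {N | IsOpen N ∧ CP3.HasNormalForm f N}, isOpen_sUnion fun N hN => hN.1,
    dense_iff_inter_open.2 fun O hO hne => ?_, ?_⟩, CP3.types_disjoint hf⟩
  · obtain ⟨N, hs, ho, ⟨q, hq⟩, h⟩ := CP3.exists_hasNormalForm hf hO hne
    exact ⟨q, hs hq, N, ⟨ho, h⟩, hq⟩
  · rintro q₀ ⟨N, ⟨ho, h⟩, hq⟩
    exact ⟨N, Set.subset_sUnion_of_mem ⟨ho, h⟩, ho, hq, h⟩
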